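/- Let $M$ be a finite monoid. For $m\in M$ consider the ideal $MmM$; idempotents $e,f$ are conjugate if $MeM=MfM$. Assume that $M$ is an orthogroup: $m\in mMm$ for all $m\in M$, and each conjugacy class of idempotents is a subsemigroup. A principal ideal $X$ is primary if $M_X=\{m\in M: X\subseteq MmM\}$ is a submonoid; $\Lambda(M)$ is the poset of primary ideals under inclusion, and $\sigma(m)$ is the largest primary ideal contained in $MmM$. For an idempotent $e$, let $G_e$ be the group of units of $eMe$; these are the maximal subgroups of $M$. Let $k$ be a field whose characteristic divides the order of no maximal subgroup of $M$, and such that $k$ is a splitting field for $M$, i.e. $kM/\mathrm{rad}(kM)$ is isomorphic to a product of matrix algebras over $k$. Let $X,Y\in\Lambda(M)$, let $e_X,e_Y$ be idempotents with $Me_XM=X$, $Me_YM=Y$, put $G_X=G_{e_X}$, $G_Y=G_{e_Y}$, and let $U$, $V$ be irreducible representations over $k$ of $G_X$, $G_Y$. They are viewed as $kM$-modules by letting $m\in M$ act on $U$ as $e_Xme_X\in G_X$ if $X\subseteq MmM$ and as $0$ otherwise, and similarly for $V$. The number of arrows from $U$ to $V$ in the quiver $Q(kM)$ is $\dim_k\mathrm{Ext}^1_{kM}(U,V)$.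 Then the following hold. 1. If $X,Y$ are incomparable or $X=Y$, there are no arrows from $U$ to $V$ in $Q(kM)$. 2. Let $X<Y$. One may assume $e_X<e_Y$ (that is, $e_X\ne e_Y$ and $e_Ye_X=e_X=e_Xe_Y$): there is an idempotent $f<e_Y$ with $MfM=X$ and an irreducible representation of $G_f$ on the space $U$ inducing the same $kM$-module as the given representation of $G_X$. Assume $e_X<e_Y$, and let $L_{e_X}=\{l\in M: Ml=Me_X\}$. Let $\equiv$ be the smallest equivalence relation on $e_YL_{e_X}$ such that (a) $e_Ymx\equiv e_Yme_Yx$ for all $x\in L_{e_X}$ and $m\in M$ with $\sigma(m)\ge X$; (b) $x\equiv x'$ whenever $x,x'\in e_YL_{e_X}$, $e_Xx=e_Xx'$, and there is an idempotent $e\in e_YMe_Y$ with $X<\sigma(e)$, $e\neq e_Y$, $ex=x$ and $ex'=x'$. Write $[x]$ for the class of $x$, and let $V_{X,Y}$ be the subspace of $k[e_YL_{e_X}/{\equiv}]$ spanned by the differences $[x]-[e_Xx]$ with $x\in e_YL_{e_X}\setminus G_X$. The distinct nonzero vectors among these differences form a basis of $V_{X,Y}$, and $V_{X,Y}$ is a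 $G_Y\times G_X$-module via $$(g,h)([x]-[e_Xx])=[gxh^{-1}]-[ge_Xxh^{-1}].$$ With $U^*=\mathrm{Hom}_k(U,k)$ the contragredient of $U$, the $G_Y\times G_X$-module $V\otimes_kU^*$ is irreducible, and the number of arrows from $U$ to $V$ in $Q(kM)$ is its multiplicity as an irreducible constituent of $V_{X,Y}$. 3. If $Y<X$, the number of arrows from $U$ to $V$ in $Q(kM)$ equals the number of arrows from $V$ to $U$ in $Q(kM^{op})$, where $U,V$ are regarded as irreducible representations of the maximal subgroups $G_X^{op},G_Y^{op}$ of $M^{op}$ by passing to the dual spaces $\mathrm{Hom}_k(U,k)$, $\mathrm{Hom}_k(V,k)$ with the transposed action $(f\cdot g)(u)=f(gu)$. If $e_Y<e_X$, this number is given by the description in part 2 applied to $M^{op}$, the idempotents $e_Y<e_X$ and these dual representations. -/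

import Mathlib

open scoped TensorProduct MonoidAlgebra
open CategoryTheory

universe u v w

namespace OrthogroupQuiver

/-! ### Ideals, the support lattice, orthogroups -/

section Monoids

variable {M : Type v} [Monoid M]

/-- The principal two-sided ideal `MmM`. -/
def twoSided (m : M) : Set M := {x | ∃ a b : M, x = a * m * b}

/-- The principal left ideal `Mm`. -/
def leftIdeal (m : M) : Set M := {x | ∃ a : M, x = a * m}

/-- The set `M_X` of all `m` with `X ⊆ MmM`. -/
def above (X : Set M) : Set M := {m | X ⊆ twoSided m}

/-- A principal ideal `X` is primary if `M_X` is a submonoid. -/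
def IsPrimary (X : Set M) : Prop :=
  (∃ m : M, X = twoSided m) ∧ ∃ S : Submonoid M, (S : Set M) = above X

variable (M) in
/-- The support lattice `Λ(M)`: primary ideals, ordered by inclusion. -/
abbrev SupportLattice : Type v := {X : Set M // IsPrimary X}

/-- The support `σ(m)`: the largest primary ideal contained in `MmM`, written as the union of all
primary ideals contained in `MmM`. -/
def support (m : M) : Set M := ⋃₀ {X : Set M | IsPrimary X ∧ X ⊆ twoSided m}

variable (M) in
/-- `M` is rectangular if each conjugacy class of idempotents is a subsemigroup; idempotents
`e, f` are conjugate when `MeM = MfM`. -/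
def IsRectangular : Prop :=
  ∀ e f : M, IsIdempotentElem e → IsIdempotentElem f → twoSided e = twoSided f →
    IsIdempotentElem (e * f) ∧ twoSided (e * f) = twoSided e

variable (M) in
/-- An orthogroup is a (von Neumann) regular rectangular monoid. -/
structure IsOrthogroup : Prop where
  regular : ∀ m : M, ∃ n : M, m = m * n * m
  rectangular : IsRectangular M

/-- The local monoid `eMe` at an idempotent `e`. -/
def LocalMonoid {e : M} (_he : IsIdempotentElem e) : Type v :=
  {m : M // e * m = m ∧ m * e = m}

/-- `eMe` is a monoid with identity `e`. -/
instance {e : M} (he : IsIdempotentElem e) : Monoid (LocalMonoid he) where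
  mul a b := ⟨a.1 * b.1, by rw [← mul_assoc, a.2.1], by rw [mul_assoc, b.2.2]⟩
  one := ⟨e, he, he⟩
  mul_assoc a b c := Subtype.ext (mul_assoc a.1 b.1 c.1)
  one_mul a := Subtype.ext a.2.1
  mul_one a := Subtype.ext a.2.2

instance {e : M} (he : IsIdempotentElem e) [Finite M] : Finite (LocalMonoid he) :=
  inferInstanceAs (Finite {m : M // e * m = m ∧ m * e = m})

/-- The maximal subgroup `G_e`: the group of units of `eMe`. -/
abbrev MaxSubgroup {e : M} (he : IsIdempotentElem e) : Type v := (LocalMonoid he)ˣ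

/-- The element of `M` underlying an element of `G_e`. -/
def MaxSubgroup.val {e : M} {he : IsIdempotentElem e} (g : MaxSubgroup he) : M :=
  (g : LocalMonoid he).1

theorem MaxSubgroup.val_mul {e : M} {he : IsIdempotentElem e} (g h : MaxSubgroup he) :
    (g * h).val = g.val * h.val := rfl

theorem MaxSubgroup.val_one {e : M} {he : IsIdempotentElem e} :
    (1 : MaxSubgroup he).val = e := rfl

theorem MaxSubgroup.left_mul {e : M} {he : IsIdempotentElem e} (g : MaxSubgroup he) :
    e * g.val = g.val := (g : LocalMonoid he).2.1

theorem MaxSubgroup.mul_right {e : M} {he : IsIdempotentElem e} (g : MaxSubgroup he) :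
    g.val * e = g.val := (g : LocalMonoid he).2.2

theorem MaxSubgroup.inv_mul_val {e : M} {he : IsIdempotentElem e} (g : MaxSubgroup he) :
    (g⁻¹).val * g.val = e := by
  rw [← val_mul, inv_mul_cancel, val_one]

theorem MaxSubgroup.mul_inv_val {e : M} {he : IsIdempotentElem e} (g : MaxSubgroup he) :
    g.val * (g⁻¹).val = e := by
  rw [← val_mul, mul_inv_cancel, val_one]

/-! ### The retraction `M_X → G_X`, `m ↦ e m e` -/

theorem mem_twoSided_self (m : M) : m ∈ twoSided m := ⟨1, 1, by simp⟩

theorem twoSided_subset_iff {m n : M} : twoSided m ⊆ twoSided n ↔ m ∈ twoSided n := by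
  refine ⟨fun h => h (mem_twoSided_self m), ?_⟩
  rintro ⟨a, b, rfl⟩ x ⟨c, d, rfl⟩
  exact ⟨c * a, b * d, by simp only [mul_assoc]⟩

theorem twoSided_eq {m n : M} (h : m ∈ twoSided n) (h' : n ∈ twoSided m) :
    twoSided m = twoSided n :=
  (twoSided_subset_iff.2 h).antisymm (twoSided_subset_iff.2 h')

/-- Both factors of a product in `M_X` lie in `M_X`. -/
theorem of_mul_mem {e m n : M} (h : e ∈ twoSided (m * n)) :
    e ∈ twoSided m ∧ e ∈ twoSided n := by
  obtain ⟨a, b, h⟩ := h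
  exact ⟨⟨a, n * b, by rw [h]; simp only [mul_assoc]⟩, ⟨a * m, b, by rw [h]; simp only [mul_assoc]⟩⟩

/-- If `e ∈ MmM` and `e ∈ MnM` then `e ∈ MmnM`. -/
theorem IsRectangular.mul_mem (hM : IsRectangular M) {e m n : M} (he : IsIdempotentElem e)
    (hm : e ∈ twoSided m) (hn : e ∈ twoSided n) : e ∈ twoSided (m * n) := by
  obtain ⟨a, b, hm⟩ := hm
  obtain ⟨c, d, hn⟩ := hn
  have h1 : ∀ x : M, e * (e * x) = e * x := fun x => by rw [← mul_assoc, he.eq]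
  have h2 : ∀ x : M, a * (m * (b * x)) = e * x := fun x => by rw [hm]; simp only [mul_assoc]
  have h3 : ∀ x : M, c * (n * (d * x)) = e * x := fun x => by rw [hn]; simp only [mul_assoc]
  have h2' : a * (m * b) = e := by rw [hm]; simp only [mul_assoc]
  have h3' : c * (n * d) = e := by rw [hn]; simp only [mul_assoc]
  have hf : IsIdempotentElem (b * e * a * m) := by
    simp only [IsIdempotentElem, mul_assoc, h2, h1]
  have hg : IsIdempotentElem (n * d * e * c) := by
    simp only [IsIdempotentElem, mul_assoc, h3, h1]
  have hfe : twoSided (b * e * a * m) = twoSided e :=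
    twoSided_eq ⟨b, a * m, by simp only [mul_assoc]⟩
      ⟨a * m, b, by simp only [mul_assoc, h2, h2', h1, he.eq]⟩
  have hge : twoSided (n * d * e * c) = twoSided e :=
    twoSided_eq ⟨n * d, c, by simp only [mul_assoc]⟩
      ⟨c, n * d, by simp only [mul_assoc, h3, h3', h1, he.eq]⟩
  have := (hM _ _ hf hg (hfe.trans hge.symm)).2
  rw [hfe] at this
  have he' : e ∈ twoSided (b * e * a * m * (n * d * e * c)) := this ▸ mem_twoSided_self e
  obtain ⟨x, y, h⟩ := he'
  exact ⟨x * b * e * a, d * e * c * y, h.trans (by simp only [mul_assoc])⟩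

/-- An element of `eMe` whose ideal contains `e` is a unit of `eMe`. -/
theorem isUnit_local [Finite M] {e : M} (he : IsIdempotentElem e) (c : LocalMonoid he)
    (hc : e ∈ twoSided c.1) : IsUnit c := by
  obtain ⟨a, b, h⟩ := hc
  let a' : LocalMonoid he := ⟨e * a * e, by simp only [mul_assoc, ← mul_assoc e e, he.eq],
    by simp only [mul_assoc, he.eq]⟩
  let b' : LocalMonoid he := ⟨e * b * e, by simp only [mul_assoc, ← mul_assoc e e, he.eq],
    by simp only [mul_assoc, he.eq]⟩
  have h1 : a' * c * b' = 1 := by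
    apply Subtype.ext
    change e * a * e * c.1 * (e * b * e) = e
    have : e * a * e * c.1 * (e * b * e) = e * (a * (e * c.1 * e) * b) * e := by
      simp only [mul_assoc]
    rw [this, c.2.1, c.2.2, ← h, he.eq, he.eq]
  have h2 : c * (b' * a') = 1 := by
    have : a' * (c * b') = 1 := by rw [← mul_assoc]; exact h1
    rw [← mul_assoc]
    exact mul_eq_one_symm this
  exact IsUnit.of_mul_eq_one _ h2

theorem IsRectangular.sandwich [Finite M] (hM : IsRectangular M) {e f : M}
    (he : IsIdempotentElem e) (hf : IsIdempotentElem f) (h : twoSided e = twoSided f) :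
    e * f * e = e := by
  obtain ⟨h1, h2⟩ := hM e f he hf h
  have hi : e * f * e * (e * f * e) = e * f * e := by
    have : e * f * e * (e * f * e) = e * f * (e * e) * f * e := by simp only [mul_assoc]
    rw [this, he.eq, mul_assoc (e * f) e f, h1.eq]
  have hmem : e ∈ twoSided (e * f * e) :=
    hM.mul_mem he (h2 ▸ mem_twoSided_self e) (mem_twoSided_self e)
  let c : LocalMonoid he := ⟨e * f * e, by simp only [← mul_assoc, he.eq],
    by simp only [mul_assoc, he.eq]⟩
  have hu : IsUnit c := isUnit_local he c hmem
  have hc : c * c = c * 1 := by rw [mul_one]; exact Subtype.ext hi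
  exact congrArg Subtype.val (hu.mul_left_cancel hc)

/-- `e m e n e = e m n e` for `m, n ∈ M_X`, `X = MeM`. -/
theorem IsRectangular.retract_mul [Finite M] (hM : IsRectangular M) {e m n : M}
    (he : IsIdempotentElem e) (hm : e ∈ twoSided m) (hn : e ∈ twoSided n) :
    e * m * e * (e * n * e) = e * (m * n) * e := by
  have key : ∀ x : M, e ∈ twoSided x → ∃ w : M, e * w = w ∧ w * e = w ∧
      e * x * w = e ∧ w * x * e = e := by
    intro x hx
    let c : LocalMonoid he := ⟨e * x * e, by simp only [← mul_assoc, he.eq],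
      by simp only [mul_assoc, he.eq]⟩
    obtain ⟨u, hu⟩ := isUnit_local he c (hM.mul_mem he
      (hM.mul_mem he (mem_twoSided_self e) hx) (mem_twoSided_self e))
    refine ⟨(↑u⁻¹ : LocalMonoid he).1, (↑u⁻¹ : LocalMonoid he).2.1,
      (↑u⁻¹ : LocalMonoid he).2.2, ?_, ?_⟩
    · have h1 : c * (↑u⁻¹ : LocalMonoid he) = 1 := by rw [← hu]; exact u.mul_inv
      have h2 : e * x * e * (↑u⁻¹ : LocalMonoid he).1 = e := congrArg Subtype.val h1
      rwa [mul_assoc (e * x), (↑u⁻¹ : LocalMonoid he).2.1] at h2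
    · have h1 : (↑u⁻¹ : LocalMonoid he) * c = 1 := by rw [← hu]; exact u.inv_mul
      have h2 : (↑u⁻¹ : LocalMonoid he).1 * (e * x * e) = e := congrArg Subtype.val h1
      rwa [← mul_assoc, ← mul_assoc, (↑u⁻¹ : LocalMonoid he).2.2] at h2
  obtain ⟨w, hw1, hw2, hw3, -⟩ := key m hm
  obtain ⟨z, hz1, hz2, -, hz4⟩ := key n hn
  have hp : IsIdempotentElem (w * m) := by
    change w * m * (w * m) = w * m
    calc w * m * (w * m) = w * (e * m * w) * m := by
          simp only [← mul_assoc, hw2]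
      _ = w * m := by rw [hw3, hw2]
  have hq : IsIdempotentElem (n * z) := by
    change n * z * (n * z) = n * z
    calc n * z * (n * z) = n * (z * n * e) * z := by
          simp only [mul_assoc, hz1]
      _ = n * z := by rw [hz4, mul_assoc, hz1]
  have hpe : twoSided (w * m) = twoSided e := by
    refine twoSided_eq ⟨w, m, by rw [hw2]⟩ ⟨e * m, w, ?_⟩
    calc e = (e * m * w) * (e * m * w) := by rw [hw3, he.eq]
      _ = e * m * (w * m) * w := by simp only [← mul_assoc]; rw [mul_assoc (e * m) w e, hw2]
  have hqe : twoSided (n * z) = twoSided e := by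
    refine twoSided_eq ⟨n, z, by rw [mul_assoc, hz1]⟩ ⟨z, n * e, ?_⟩
    calc e = (z * n * e) * (z * n * e) := by rw [hz4, he.eq]
      _ = z * (n * z) * (n * e) := by simp only [mul_assoc]; rw [← mul_assoc e z, hz1]
  have h1 : e * m * (w * m) = e * m := by
    rw [← mul_assoc, hw3]
  have h2 : n * z * (n * e) = n * e := by
    calc n * z * (n * e) = n * (z * n * e) := by simp only [mul_assoc]
      _ = n * e := by rw [hz4]
  have h3 : w * m * e * (n * z) = w * m * (n * z) := by
    obtain ⟨ha, hb⟩ := hM e (n * z) he hq hqe.symm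
    calc w * m * e * (n * z) = w * m * e * (n * z * (w * m) * (n * z)) := by
          rw [hM.sandwich hq hp (hqe.trans hpe.symm)]
      _ = w * m * (e * (n * z)) * (w * m) * (n * z) := by simp only [mul_assoc]
      _ = w * m * (n * z) := by rw [hM.sandwich hp ha (hpe.trans hb.symm)]
  calc e * m * e * (e * n * e) = e * m * (e * e) * (n * e) := by simp only [mul_assoc]
    _ = e * m * (w * m) * e * (n * z * (n * e)) := by rw [he.eq, h1, h2]
    _ = e * m * (w * m * e * (n * z)) * (n * e) := by simp only [mul_assoc]
    _ = e * m * (w * m) * (n * z * (n * e)) := by rw [h3]; simp only [mul_assoc]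
    _ = e * (m * n) * e := by rw [h1, h2]; simp only [mul_assoc]

/-- The element `e m e` of `G_e`, for `m` with `MeM ⊆ MmM`. -/
noncomputable def retract [Finite M] (hM : IsRectangular M) {e : M} (he : IsIdempotentElem e)
    (m : M) (hm : m ∈ above (twoSided e)) : MaxSubgroup he :=
  (isUnit_local he ⟨e * m * e, by simp only [← mul_assoc, he.eq],
      by simp only [mul_assoc, he.eq]⟩
    (hM.mul_mem he (hM.mul_mem he (mem_twoSided_self e) (twoSided_subset_iff.1 hm))
      (mem_twoSided_self e))).unit

theorem val_retract [Finite M] (hM : IsRectangular M) {e : M} (he : IsIdempotentElem e)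
    (m : M) (hm : m ∈ above (twoSided e)) : (retract hM he m hm).val = e * m * e := rfl

theorem MaxSubgroup.ext {e : M} {he : IsIdempotentElem e} {g h : MaxSubgroup he}
    (hgh : g.val = h.val) : g = h :=
  Units.ext (Subtype.ext hgh)

end Monoids

/-! ### Representations and the number of arrows -/

section Representations

variable {k : Type u} {M : Type v} [Field k] [Monoid M]

open scoped Classical in
/-- A representation `σ` of the maximal subgroup `G_e` viewed as a representation of `M`:
`m` acts as `σ(e m e)` if `MeM ⊆ MmM`, and as `0` otherwise. -/
noncomputable def inflate [Finite M] (hM : IsRectangular M) {e : M} {he : IsIdempotentElem e}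
    {U : Type w} [AddCommGroup U] [Module k U] (σ : Representation k (MaxSubgroup he) U) :
    Representation k M U where
  toFun m := if hm : m ∈ above (twoSided e) then σ (retract hM he m hm) else 0
  map_one' := by
    have h1 : (1 : M) ∈ above (twoSided e) := twoSided_subset_iff.2 ⟨e, 1, by simp⟩
    rw [dif_pos h1, ← map_one σ]
    congr 1
    apply MaxSubgroup.ext
    rw [val_retract, mul_one, he.eq, MaxSubgroup.val_one]
  map_mul' m n := by
    by_cases hm : m ∈ above (twoSided e)
    · by_cases hn : n ∈ above (twoSided e)
      · have hmn : m * n ∈ above (twoSided e) := twoSided_subset_iff.2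
          (hM.mul_mem he (twoSided_subset_iff.1 hm) (twoSided_subset_iff.1 hn))
        rw [dif_pos hm, dif_pos hn, dif_pos hmn, ← map_mul σ]
        congr 1
        apply MaxSubgroup.ext
        rw [MaxSubgroup.val_mul, val_retract, val_retract, val_retract,
          hM.retract_mul he (twoSided_subset_iff.1 hm) (twoSided_subset_iff.1 hn)]
      · have hmn : m * n ∉ above (twoSided e) := fun h =>
          hn (twoSided_subset_iff.2 (of_mul_mem (twoSided_subset_iff.1 h)).2)
        rw [dif_neg hn, dif_neg hmn, mul_zero]
    · have hmn : m * n ∉ above (twoSided e) := fun h =>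
        hm (twoSided_subset_iff.2 (of_mul_mem (twoSided_subset_iff.1 h)).1)
      rw [dif_neg hm, dif_neg hmn, zero_mul]

variable (k M) in
/-- `k` is a splitting field for `M`: the algebra `kM` modulo its radical is isomorphic to a
product of matrix algebras over `k`. -/
def IsSplittingField : Prop :=
  ∃ (n : ℕ) (d : Fin n → ℕ),
    Nonempty ((k[M] ⧸ Ring.jacobson k[M]) ≃ₐ[k] (∀ i, Matrix (Fin (d i)) (Fin (d i)) k))

/-- The number of arrows from (the isomorphism class of) `ρ` to that of `σ` in the quiver of
`kM`, i.e. the dimension over `k` of `Ext¹_{kM}(ρ, σ)`. -/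
noncomputable def numArrows {U V : Type (max u v)} [AddCommGroup U] [Module k U]
    [AddCommGroup V] [Module k V] (ρ : Representation k M U) (σ : Representation k M V) :
    Cardinal.{max u v} :=
  Module.rank k (Abelian.Ext.{max u v} (ModuleCat.of.{max u v} k[M] ρ.asModule)
    (ModuleCat.of.{max u v} k[M] σ.asModule) 1)

/-- `n` is the multiplicity of the irreducible representation `ω` as a constituent of the
completely reducible representation `τ`: in a decomposition of `τ` as an internal direct sum of
irreducible subrepresentations, exactly `n` summands are isomorphic to `ω`. -/
def HasMultiplicity {G : Type*} [Monoid G] {W R : Type*} [AddCommGroup W] [Module k W]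
    [AddCommGroup R] [Module k R] (ω : Representation k G W) (τ : Representation k G R)
    (n : ℕ) : Prop :=
  ∃ (m : ℕ) (S : Fin m → Submodule k[G] τ.asModule), DirectSum.IsInternal S ∧
    (∀ i, IsSimpleModule k[G] (S i)) ∧ Nat.card {i // Nonempty (S i ≃ₗ[k[G]] ω.asModule)} = n

/-- The representation `V ⊗ U*` of `H × G`, for `U` a representation of `G` and `V` one of `H`;
`U*` is the contragredient. -/
noncomputable def tensorDual {G H : Type*} [Group G] [Group H] {U V : Type*} [AddCommGroup U]
    [Module k U] [AddCommGroup V] [Module k V] (ρV : Representation k H V)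
    (ρU : Representation k G U) : Representation k (H × G) (V ⊗[k] Module.Dual k U) :=
  Representation.tprod (ρV.comp (MonoidHom.fst H G)) (ρU.dual.comp (MonoidHom.snd H G))

end Representations

/-! ### The module `V_{X,Y}` -/

section Pair

/-- A pair of idempotents `e_X ≤ e_Y` of `M`. -/
structure IdemPair (M : Type v) [Monoid M] where
  /-- the idempotent `e_X` -/
  eX : M
  /-- the idempotent `e_Y` -/
  eY : M
  idemX : IsIdempotentElem eX
  idemY : IsIdempotentElem eY
  left_mul : eY * eX = eX
  right_mul : eX * eY = eX

variable {M : Type v} [Monoid M] (P : IdemPair M)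

namespace IdemPair

/-- The `ℒ`-class `L_{e_X} = {l | Ml = Me_X}`. -/
def lClass : Set M := {l | leftIdeal l = leftIdeal P.eX}

/-- The set `e_Y L_{e_X}`. -/
def carrier : Set M := {x | ∃ l ∈ P.lClass, x = P.eY * l}

/-- The relations (a) and (b) generating `≡` on `e_Y L_{e_X}`, where `X = M e_X M`. -/
inductive Rel : P.carrier → P.carrier → Prop
  | a (x x' : P.carrier) (m l : M) (hm : twoSided P.eX ⊆ support m) (hl : l ∈ P.lClass)
      (hx : (x : M) = P.eY * m * l) (hx' : (x' : M) = P.eY * m * P.eY * l) : Rel x x'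
  | b (x x' : P.carrier) (h : P.eX * (x : M) = P.eX * (x' : M)) (e : M)
      (he : IsIdempotentElem e) (hmem : ∃ m : M, e = P.eY * m * P.eY)
      (hX : twoSided P.eX ⊂ support e) (hne : e ≠ P.eY)
      (hx : e * (x : M) = x) (hx' : e * (x' : M) = x') : Rel x x'

/-- The smallest equivalence relation `≡` on `e_Y L_{e_X}` containing (a) and (b). -/
def equivRel : Setoid P.carrier := Relation.EqvGen.setoid P.Rel

/-- The set of `≡`-classes. -/
def Classes : Type v := Quotient P.equivRel

/-- The vector space with basis the set of `≡`-classes. -/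
abbrev ClassSpace (k : Type u) [Field k] : Type (max u v) := P.Classes →₀ k

variable (k : Type u) [Field k]

/-- The basis vector `[x]`. -/
noncomputable def cls (x : P.carrier) : P.ClassSpace k :=
  Finsupp.single (Quotient.mk P.equivRel x) 1

theorem eY_mul (x : P.carrier) : P.eY * (x : M) = x := by
  obtain ⟨x, l, hl, rfl⟩ := x
  change P.eY * (P.eY * l) = P.eY * l
  rw [← mul_assoc, P.idemY.eq]

theorem mul_eX (x : P.carrier) : (x : M) * P.eX = x := by
  obtain ⟨x, l, hl, rfl⟩ := x
  have h : l ∈ leftIdeal P.eX := hl ▸ ⟨1, (one_mul l).symm⟩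
  obtain ⟨a, rfl⟩ := h
  change P.eY * (a * P.eX) * P.eX = P.eY * (a * P.eX)
  simp only [mul_assoc, P.idemX.eq]

theorem mem_carrier {z u : M} (h1 : P.eY * z = z) (h2 : z * P.eX = z) (h3 : u * z = P.eX) :
    z ∈ P.carrier := by
  refine ⟨z, Set.Subset.antisymm ?_ ?_, h1.symm⟩
  · rintro _ ⟨a, rfl⟩
    exact ⟨a * z, by rw [mul_assoc, h2]⟩
  · rintro _ ⟨a, rfl⟩
    exact ⟨a * u, by rw [mul_assoc, h3]⟩

theorem exists_mul_eq [Finite M] (hM : IsRectangular M) (x : P.carrier) :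
    ∃ w : M, w * (P.eX * (x : M)) = P.eX := by
  have hx : P.eX ∈ twoSided (x : M) := by
    obtain ⟨x, l, hl, rfl⟩ := x
    have h : P.eX ∈ leftIdeal l := hl ▸ ⟨1, (one_mul _).symm⟩
    obtain ⟨a, ha⟩ := h
    exact hM.mul_mem P.idemX ⟨1, P.eX, by rw [one_mul, P.left_mul]⟩ ⟨a, 1, by rw [mul_one, ← ha]⟩
  let c : LocalMonoid P.idemX := ⟨P.eX * (x : M), by rw [← mul_assoc, P.idemX.eq],
    by rw [mul_assoc, P.mul_eX]⟩
  obtain ⟨u, hu⟩ := isUnit_local P.idemX c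
    (hM.mul_mem P.idemX (mem_twoSided_self _) hx)
  refine ⟨(↑u⁻¹ : LocalMonoid P.idemX).1, ?_⟩
  have h1 : (↑u⁻¹ : LocalMonoid P.idemX) * c = 1 := by rw [← hu]; exact u.inv_mul
  exact congrArg Subtype.val h1

/-- The element `e_X x` of `e_Y L_{e_X}`. -/
def retr [Finite M] (hM : IsRectangular M) (x : P.carrier) : P.carrier :=
  ⟨P.eX * x, by
    obtain ⟨w, hw⟩ := P.exists_mul_eq hM x
    exact P.mem_carrier (by rw [← mul_assoc, P.left_mul]) (by rw [mul_assoc, P.mul_eX]) hw⟩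

/-- The element `g x h⁻¹` of `e_Y L_{e_X}`. -/
def act [Finite M] (hM : IsRectangular M) (g : MaxSubgroup P.idemY) (h : MaxSubgroup P.idemX)
    (x : P.carrier) : P.carrier :=
  ⟨g.val * x * (h⁻¹).val, by
    obtain ⟨w, hw⟩ := P.exists_mul_eq hM x
    refine P.mem_carrier (u := h.val * (w * P.eX) * (g⁻¹).val) ?_ ?_ ?_
    · rw [← mul_assoc, ← mul_assoc, g.left_mul]
    · rw [mul_assoc, (h⁻¹).mul_right]
    · calc h.val * (w * P.eX) * (g⁻¹).val * (g.val * x * (h⁻¹).val)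
          = h.val * (w * P.eX) * ((g⁻¹).val * g.val * x) * (h⁻¹).val := by
            simp only [mul_assoc]
        _ = h.val * (w * (P.eX * x)) * (h⁻¹).val := by
            rw [g.inv_mul_val, P.eY_mul]; simp only [mul_assoc]
        _ = P.eX := by rw [hw, h.mul_right, h.mul_inv_val]⟩

/-- The difference `[x] - [e_X x]`. -/
noncomputable def diff [Finite M] (hM : IsRectangular M) (x : P.carrier) : P.ClassSpace k :=
  P.cls k x - P.cls k (P.retr hM x)

/-- The set of all differences `[x] - [e_X x]` with `x ∈ e_Y L_{e_X} \ G_X`. -/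
def diffSet [Finite M] (hM : IsRectangular M) : Set (P.ClassSpace k) :=
  {v | ∃ x : P.carrier, (x : M) ∉ Set.range (MaxSubgroup.val (he := P.idemX)) ∧ v = P.diff k hM x}

/-- The space `V_{X,Y}` spanned by the differences `[x] - [e_X x]`. -/
noncomputable def space [Finite M] (hM : IsRectangular M) : Submodule k (P.ClassSpace k) :=
  Submodule.span k (P.diffSet k hM)

/-- For a representation `τ` of `G_Y × G_X` on `V_{X,Y}`: it is given by
`(g, h)([x] - [e_X x]) = [g x h⁻¹] - [g e_X x h⁻¹]`. -/
def IsAction [Finite M] (hM : IsRectangular M)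
    (τ : Representation k (MaxSubgroup P.idemY × MaxSubgroup P.idemX) (P.space k hM)) : Prop :=
  ∀ (g : MaxSubgroup P.idemY) (h : MaxSubgroup P.idemX) (x : P.carrier)
    (hx : P.diff k hM x ∈ P.space k hM),
    (τ (g, h) ⟨P.diff k hM x, hx⟩ : P.ClassSpace k) =
      P.cls k (P.act hM g h x) - P.cls k (P.act hM g h (P.retr hM x))

variable {k}

/-- The description of the arrows from `U` to `V` for `e_X ≤ e_Y`: the nonzero differences form
a basis of `V_{X,Y}`, the formula for the action defines a representation of `G_Y × G_X` on
`V_{X,Y}`, the representation `V ⊗ U*` is irreducible, and the number of arrows from `U` to `V`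
is its multiplicity in `V_{X,Y}`. -/
def ArrowFormula [Finite M] (hM : IsRectangular M) {U V : Type (max u v)}
    [AddCommGroup U] [Module k U] [AddCommGroup V] [Module k V]
    (ρU : Representation k (MaxSubgroup P.idemX) U)
    (ρV : Representation k (MaxSubgroup P.idemY) V) : Prop :=
  LinearIndepOn k id {v ∈ P.diffSet k hM | v ≠ 0} ∧
  (tensorDual ρV ρU).IsIrreducible ∧
  ∃ τ : Representation k (MaxSubgroup P.idemY × MaxSubgroup P.idemX) (P.space k hM),
    P.IsAction k hM τ ∧
    ∃ n : ℕ,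
      HasMultiplicity (R := P.space k hM) (tensorDual ρV ρU) τ n ∧
      numArrows (inflate hM ρU) (inflate hM ρV) = n

end IdemPair
end Pair

/-! ### The opposite monoid -/

section Opposite

open MulOpposite

variable {M : Type v} [Monoid M]

instance finite_op [Finite M] : Finite Mᵐᵒᵖ := Finite.of_equiv M opEquiv

theorem mem_twoSided_op {x m : M} : op x ∈ twoSided (op m) ↔ x ∈ twoSided m := by
  constructor
  · rintro ⟨a, b, h⟩
    exact ⟨b.unop, a.unop, op_injective (by rw [h]; simp [mul_assoc])⟩
  · rintro ⟨a, b, rfl⟩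
    exact ⟨op b, op a, by simp [mul_assoc]⟩

theorem twoSided_op_iff {m n : M} :
    twoSided (op m) = twoSided (op n) ↔ twoSided m = twoSided n := by
  constructor
  · intro h
    ext x
    rw [← mem_twoSided_op, h, mem_twoSided_op]
  · intro h
    ext x
    rw [← op_unop x, mem_twoSided_op, h, mem_twoSided_op]

theorem isIdempotentElem_op {e : M} (he : IsIdempotentElem e) : IsIdempotentElem (op e) :=
  congrArg op he

theorem IsRectangular.op (hM : IsRectangular M) : IsRectangular Mᵐᵒᵖ := by
  intro e f he hf h
  obtain ⟨h1, h2⟩ := hM f.unop e.unop (congrArg unop hf) (congrArg unop he)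
    (twoSided_op_iff.1 h.symm)
  exact ⟨isIdempotentElem_op h1, (twoSided_op_iff.2 h2).trans h.symm⟩

/-- The pair `e_X ≤ e_Y` in the opposite monoid. -/
def IdemPair.op (P : IdemPair M) : IdemPair Mᵐᵒᵖ where
  eX := MulOpposite.op P.eX
  eY := MulOpposite.op P.eY
  idemX := isIdempotentElem_op P.idemX
  idemY := isIdempotentElem_op P.idemY
  left_mul := congrArg MulOpposite.op P.right_mul
  right_mul := congrArg MulOpposite.op P.left_mul

/-- The identity map from the maximal subgroup of `Mᵒᵖ` at `e` to the opposite of the maximal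
subgroup of `M` at `e`. -/
def maxSubgroupOp {e : M} (he : IsIdempotentElem e) :
    MaxSubgroup (isIdempotentElem_op he) →* (MaxSubgroup he)ᵐᵒᵖ :=
  (Units.opEquiv.toMonoidHom).comp <| Units.map
    { toFun := fun x => MulOpposite.op
        ⟨x.1.unop, congrArg unop x.2.2, congrArg unop x.2.1⟩
      map_one' := rfl
      map_mul' := fun _ _ => rfl }

variable {k : Type u} [Field k]

/-- The dual `U* = Hom_k(U, k)` of a representation `U` of the maximal subgroup of `M` at `e`, as a
representation of the maximal subgroup of `Mᵒᵖ` at `e`: the action is `(f g)(u) = f (g u)`. -/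
noncomputable def dualOp {e : M} {he : IsIdempotentElem e} {U : Type w} [AddCommGroup U]
    [Module k U] (ρ : Representation k (MaxSubgroup he) U) :
    Representation k (MaxSubgroup (isIdempotentElem_op he)) (Module.Dual k U) :=
  MonoidHom.comp
    { toFun := fun g => (ρ g.unop).dualMap
      map_one' := by ext; simp
      map_mul' := fun g h => by ext; simp } (maxSubgroupOp he)

end Opposite

end OrthogroupQuiver

open OrthogroupQuiver

/-! The group `Ext¹(U, V)` is computed from the presentation `k[M] ⊗ U → U`, whose kernel is spanned
by the elements `m ⊗ u - 1 ⊗ mu`. Homomorphisms from this kernel to `V` are crossed homomorphisms `d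
: M → Hom(U, V)`, `d(mn) = m d(n) + d(m) n`, and those that extend to `k[M] ⊗ U` are the inner ones
(`exists_crossedHom_ext`).

Two facts about orthogroups do the semigroup work. Every principal ideal is primary, so the support
of `m` is `MmM`; and inside one `𝒥`-class an idempotent of that class can be inserted into any
product (`IsOrthogroup.mul_idem_mul`). Regularity moreover makes `d` vanish on elements that kill
both `U` and `V` (`crossedHom_eq_zero`). For incomparable ideals this makes every normalised `d`
zero; for `X = Y` averaging over the maximal subgroup first makes `d` vanish on that subgroup.

For `X < Y` each class contains exactly one `d` with `d(e_X) = 0`, because the inner crossed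
homomorphism of `φ` takes the value `-φ` at `e_X`. Such a `d` satisfies `d(m) = d(e_Y m e_X)` when
`e_X ∈ MmM` and is zero elsewhere, so it is a function on `e_Y L_{e_X}`. The functions that arise
are those constant on `≡`, zero on the elements `e_X x`, and equivariant in the sense of `cocycles`
(`cocycles_mul`, `crossedHom_mem_cocycles`). They are the intertwining maps from `V_{X,Y}` to
`Hom(U, V) = V ⊗ U*` (`nonempty_intertwining_equiv_cocycles`).

Over a splitting field the operators of an irreducible representation of a maximal subgroup span all
endomorphisms. This property passes to duals and outer tensor products, so `V ⊗ U*` is irreducible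
with scalar commutant; by Maschke and Schur the dimension of the space of intertwining maps is the
multiplicity. The case `Y < X` follows by transposing crossed homomorphisms, which interchanges `M`
and its opposite. -/

namespace OrthogroupQuiver

/-! ### First extension groups from a projective presentation. -/

section FirstExt

open Abelian

variable {k : Type u} [Field k] {A : Type v} [Ring A] [Algebra k A]

/-- The connecting map `Hom(X₁, Y) → Ext¹(X₃, Y)` of a short exact sequence of modules. -/
noncomputable def connecting {S : ShortComplex (ModuleCat.{max v w} A)} (hS : S.ShortExact)
    (Y : ModuleCat.{max v w} A) : (S.X₁ ⟶ Y) →ₗ[k] Ext.{max v w} S.X₃ Y 1 :=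
  (Ext.precompOfLinear hS.extClass k Y (add_zero 1)).comp
    (Ext.linearEquiv₀ (R := k)).symm.toLinearMap

/-- In the long exact sequence the next term is `Ext¹` of the projective middle object, which
vanishes. -/
theorem connecting_surjective {S : ShortComplex (ModuleCat.{max v w} A)} (hS : S.ShortExact)
    [Projective S.X₂] (Y : ModuleCat.{max v w} A) :
    Function.Surjective (connecting (k := k) hS Y) := by
  intro x
  obtain ⟨y, hy⟩ := Ext.contravariant_sequence_exact₃ hS Y x (Ext.eq_zero_of_projective _)
    (add_zero 1)
  refine ⟨Ext.linearEquiv₀ (R := k) y, ?_⟩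
  simpa [connecting] using hy

/-- This is exactness of the long exact sequence at `Hom(X₁, Y)`, written for morphisms instead of
degree-zero Ext classes. -/
theorem connecting_eq_zero_iff {S : ShortComplex (ModuleCat.{max v w} A)} (hS : S.ShortExact)
    (Y : ModuleCat.{max v w} A) (φ : S.X₁ ⟶ Y) :
    connecting (k := k) hS Y φ = 0 ↔ ∃ ψ : S.X₂ ⟶ Y, S.f ≫ ψ = φ := by
  have h : connecting (k := k) hS Y φ = hS.extClass.comp (Ext.mk₀ φ) (add_zero 1) := rfl
  rw [h]
  constructor
  · intro h0
    obtain ⟨y, hy⟩ := Ext.contravariant_sequence_exact₁ hS Y _ (add_zero 1) h0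
    refine ⟨Ext.addEquiv₀ y, ?_⟩
    apply Ext.addEquiv₀.symm.injective
    change Ext.mk₀ _ = Ext.mk₀ _
    rw [← hy, ← Ext.mk₀_comp_mk₀]
    congr 1
    exact Ext.addEquiv₀.symm_apply_apply y
  · rintro ⟨ψ, rfl⟩
    rw [← Ext.mk₀_comp_mk₀, hS.extClass_comp_assoc]

/-- `Ext¹(N, T)` as a quotient of the space of homomorphisms on the kernel of a projective
presentation of `N`. -/
theorem exists_ext_of_presentation {P N T D : Type (max v w)} [AddCommGroup P] [Module A P]
    [AddCommGroup N] [Module A N] [AddCommGroup T] [Module A T] [AddCommGroup D] [Module k D]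
    [Module.Projective A P] {π : P →ₗ[A] N} (hπ : Function.Surjective π)
    (θ : D → (LinearMap.ker π →ₗ[A] T)) (hadd : ∀ d d', θ (d + d') = θ d + θ d')
    (hsmul : ∀ (c : k) d p, θ (c • d) p = algebraMap k A c • θ d p)
    (hθ : Function.Surjective θ) :
    ∃ q : D →ₗ[k] Ext.{max v w} (ModuleCat.of.{max v w} A N) (ModuleCat.of.{max v w} A T) 1,
      Function.Surjective q ∧
        ∀ d, q d = 0 ↔ ∃ ψ : P →ₗ[A] T, ψ ∘ₗ (LinearMap.ker π).subtype = θ d := by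
  have hS := LinearMap.shortExact_shortComplexKer hπ
  have : Projective π.shortComplexKer.X₂ := (IsProjective.iff_projective P).1 inferInstance
  let Y := ModuleCat.of.{max v w} A T
  let F : D → (π.shortComplexKer.X₁ ⟶ Y) := fun d => ModuleCat.ofHom (θ d)
  have h1 : ∀ d d', F (d + d') = F d + F d' := fun d d' => by
    ext p
    exact LinearMap.congr_fun (hadd d d') p
  have h2 : ∀ (c : k) d, F (c • d) = c • F d := fun c d => by
    ext p
    exact hsmul c d p
  let q : D →ₗ[k] Ext.{max v w} π.shortComplexKer.X₃ Y 1 :=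
    { toFun := fun d => connecting (k := k) hS Y (F d)
      map_add' := fun d d' => by rw [h1, map_add]
      map_smul' := fun c d => by rw [h2, map_smul, RingHom.id_apply] }
  have hq : ∀ d, q d = connecting (k := k) hS Y (F d) := fun _ => rfl
  have hker : ∀ d, q d = 0 ↔ ∃ ψ : P →ₗ[A] T, ψ ∘ₗ (LinearMap.ker π).subtype = θ d := by
    intro d
    rw [hq]
    constructor
    · intro h
      obtain ⟨ψ, hψ⟩ := (connecting_eq_zero_iff hS Y (F d)).1 h
      exact ⟨ψ.hom, congrArg ModuleCat.Hom.hom hψ⟩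
    · rintro ⟨ψ, hψ⟩
      refine (connecting_eq_zero_iff hS Y (F d)).2 ⟨ModuleCat.ofHom ψ, ?_⟩
      ext p
      exact LinearMap.congr_fun hψ p
  refine ⟨q, fun x => ?_, hker⟩
  · obtain ⟨χ, hχ⟩ := connecting_surjective (k := k) hS Y x
    obtain ⟨d, hd⟩ := hθ χ.hom
    refine ⟨d, ?_⟩
    rw [hq, ← hχ]
    congr 1
    ext p
    exact LinearMap.congr_fun hd p

end FirstExt

/-! ### Crossed homomorphisms and the kernel of the augmentation. -/

section CrossedHom

variable {k : Type u} {M : Type v} [Field k] [Monoid M]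
variable {U V : Type w} [AddCommGroup U] [Module k U] [AddCommGroup V] [Module k V]
variable (ρ : Representation k M U) (σ : Representation k M V)

/-- The space of crossed homomorphisms `M → Hom(U, V)`. -/
def crossedHom : Submodule k (M → U →ₗ[k] V) where
  carrier := {d | ∀ m n, d (m * n) = σ m ∘ₗ d n + d m ∘ₗ ρ n}
  zero_mem' m n := by simp
  add_mem' {d d'} h h' m n := by
    simp only [Pi.add_apply, h m n, h' m n, LinearMap.comp_add, LinearMap.add_comp]
    abel
  smul_mem' c d h m n := by
    simp only [Pi.smul_apply, h m n, LinearMap.comp_smul, LinearMap.smul_comp, smul_add]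

variable {ρ σ} in
theorem crossedHom.map_mul (d : crossedHom ρ σ) (m n : M) (u : U) :
    d.1 (m * n) u = σ m (d.1 n u) + d.1 m (ρ n u) := by
  rw [d.2 m n]; rfl

variable {ρ σ} in
theorem crossedHom.map_one (d : crossedHom ρ σ) : d.1 1 = 0 := by
  ext u
  have h := crossedHom.map_mul d 1 1 u
  simpa using h

/-- The inner crossed homomorphisms. -/
def innerHom : (U →ₗ[k] V) →ₗ[k] crossedHom ρ σ where
  toFun φ := ⟨fun m => σ m ∘ₗ φ - φ ∘ₗ ρ m, fun m n => by
    ext u; simp⟩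
  map_add' φ ψ := by
    ext m u; simp; abel
  map_smul' c φ := by
    ext m u; simp [smul_sub]

@[simp]
theorem innerHom_apply (φ : U →ₗ[k] V) (m : M) (u : U) :
    (innerHom ρ σ φ).1 m u = σ m (φ u) - φ (ρ m u) := rfl

section Resolution

open Abelian

/-- The `k[M]`-linear extension of a linear map on `U` to the induced module `k[M] ⊗ U`. -/
noncomputable def inducedLift (φ : U →ₗ[k] V) : k[M] ⊗[k] U →ₗ[k[M]] σ.asModule :=
  TensorProduct.AlgebraTensorModule.lift
    (LinearMap.toSpanSingleton k[M] (U →ₗ[k] σ.asModule) (σ.asModuleEquiv.symm.toLinearMap ∘ₗ φ))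

theorem inducedLift_tmul (φ : U →ₗ[k] V) (a : k[M]) (u : U) :
    inducedLift σ φ (a ⊗ₜ u) = σ.asAlgebraHom a (φ u) := rfl

theorem inducedLift_single (φ : U →ₗ[k] V) (m : M) (u : U) :
    inducedLift σ φ (MonoidAlgebra.single m 1 ⊗ₜ u) = σ m (φ u) := by
  rw [inducedLift_tmul, Representation.asAlgebraHom_single_one]

/-- The augmentation `k[M] ⊗ U → U`. -/
noncomputable abbrev augmentation : k[M] ⊗[k] U →ₗ[k[M]] ρ.asModule :=
  inducedLift ρ LinearMap.id

theorem augmentation_surjective : Function.Surjective (augmentation ρ) := fun u =>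
  ⟨MonoidAlgebra.single 1 1 ⊗ₜ ρ.asModuleEquiv u, by rw [inducedLift_single, map_one]; rfl⟩

/-- The projection `p ↦ p - 1 ⊗ π(p)` onto the kernel of the augmentation `π`. -/
noncomputable def toAugKer : k[M] ⊗[k] U →ₗ[k] LinearMap.ker (augmentation ρ) where
  toFun p := ⟨p - 1 ⊗ₜ ρ.asModuleEquiv (augmentation ρ p), by
    rw [LinearMap.mem_ker, map_sub, sub_eq_zero, inducedLift_tmul ρ _ (1 : k[M]), map_one]; rfl⟩
  map_add' p q := Subtype.ext <| by
    change p + q - _ = p - _ + (q - _)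
    rw [map_add, map_add, TensorProduct.tmul_add]; abel
  map_smul' c p := Subtype.ext <| by
    change c • p - _ = c • (p - _)
    rw [LinearMap.map_smul_of_tower, map_smul, TensorProduct.tmul_smul, smul_sub]

theorem toAugKer_of_mem (p : LinearMap.ker (augmentation ρ)) : toAugKer ρ p = p := by
  apply Subtype.ext
  change (p : k[M] ⊗[k] U) - _ = p
  rw [LinearMap.mem_ker.1 p.2, map_zero, TensorProduct.tmul_zero, sub_zero]

theorem coe_toAugKer_single (m : M) (u : U) :
    (toAugKer ρ (MonoidAlgebra.single m 1 ⊗ₜ u) : k[M] ⊗[k] U) =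
      MonoidAlgebra.single m 1 ⊗ₜ u - 1 ⊗ₜ ρ m u := by
  change _ - _ = _
  rw [inducedLift_single]; rfl

/-- The identity `mn ⊗ u - 1 ⊗ mnu = m(n ⊗ u - 1 ⊗ nu) + (m ⊗ nu - 1 ⊗ mnu)` among the generators of
the kernel; applying a `k[M]`-linear map to it yields the crossed homomorphism rule. -/
theorem toAugKer_single_mul (m n : M) (u : U) :
    toAugKer ρ (MonoidAlgebra.single (m * n) 1 ⊗ₜ u) =
      MonoidAlgebra.single m (1 : k) • toAugKer ρ (MonoidAlgebra.single n 1 ⊗ₜ u) +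
        toAugKer ρ (MonoidAlgebra.single m 1 ⊗ₜ ρ n u) := by
  apply Subtype.ext
  rw [Submodule.coe_add, Submodule.coe_smul, coe_toAugKer_single, coe_toAugKer_single,
    coe_toAugKer_single, smul_sub, TensorProduct.smul_tmul', TensorProduct.smul_tmul', smul_eq_mul,
    smul_eq_mul, MonoidAlgebra.single_mul_single, mul_one, mul_one, map_mul,
    Module.End.mul_apply]
  abel

/-- The `k`-linear extension `k[M] ⊗ U → V`, `m ⊗ u ↦ d(m)(u)`. -/
noncomputable def linExt : (M → U →ₗ[k] V) →ₗ[k] k[M] ⊗[k] U →ₗ[k] V :=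
  (TensorProduct.lift.equiv (RingHom.id k) k[M] U V).toLinearMap ∘ₗ
    ((MonoidAlgebra.basis M k).constr k).toLinearMap

theorem linExt_single (d : M → U →ₗ[k] V) (m : M) (u : U) :
    linExt d (MonoidAlgebra.single m 1 ⊗ₜ u) = d m u := by
  change (MonoidAlgebra.basis M k).constr k d (MonoidAlgebra.single m 1) u = _
  rw [← MonoidAlgebra.basis_apply, Module.Basis.constr_basis]

theorem linExt_unique {W : Type*} [AddCommGroup W] [Module k W] {f g : k[M] ⊗[k] U →ₗ[k] W}
    (h : ∀ m u, f (MonoidAlgebra.single m 1 ⊗ₜ u) = g (MonoidAlgebra.single m 1 ⊗ₜ u)) : f = g := by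
  ext m u
  exact h m u

-- The defect of `k[M]`-linearity of `linExt d` factors through the augmentation, so it disappears
-- on the kernel.
variable {ρ σ} in
theorem crossedHom.linExt_smul (d : crossedHom ρ σ) (m : M) (p : k[M] ⊗[k] U) :
    linExt d.1 (MonoidAlgebra.single m (1 : k) • p) =
      σ m (linExt d.1 p) + d.1 m (ρ.asModuleEquiv (augmentation ρ p)) := by
  have : linExt d.1 ∘ₗ (Algebra.lsmul k k (k[M] ⊗[k] U) (MonoidAlgebra.single m (1 : k))) =
      σ m ∘ₗ linExt d.1 +
        d.1 m ∘ₗ ρ.asModuleEquiv.toLinearMap ∘ₗ (augmentation ρ).restrictScalars k := by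
    apply linExt_unique
    intro n u
    change linExt d.1 (MonoidAlgebra.single m (1 : k) • (MonoidAlgebra.single n 1 ⊗ₜ u)) =
      σ m (linExt d.1 (MonoidAlgebra.single n 1 ⊗ₜ u)) +
        d.1 m (ρ.asModuleEquiv (augmentation ρ (MonoidAlgebra.single n 1 ⊗ₜ u)))
    rw [TensorProduct.smul_tmul', smul_eq_mul, MonoidAlgebra.single_mul_single, mul_one,
      linExt_single, linExt_single, crossedHom.map_mul d, inducedLift_single]
    rfl
  exact LinearMap.congr_fun this p

/-- A `k`-linear map commuting with the action of `M` is `k[M]`-linear. -/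
def linearOfComm {W : Type*} [AddCommGroup W] [Module k W] [Module k[M] W] [IsScalarTower k k[M] W]
    (f : W →ₗ[k] V)
    (h : ∀ (m : M) (w : W), f (MonoidAlgebra.single m (1 : k) • w) = σ m (f w)) :
    W →ₗ[k[M]] σ.asModule where
  toFun w := σ.asModuleEquiv.symm (f w)
  map_add' w w' := by rw [map_add, map_add]
  map_smul' a w := by
    rw [RingHom.id_apply]
    induction a using MonoidAlgebra.induction_on with
    | of m =>
      rw [MonoidAlgebra.of_apply, h]
      change _ = σ.asAlgebraHom (MonoidAlgebra.single m 1) _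
      rw [Representation.asAlgebraHom_single_one]; rfl
    | add x y hx hy => rw [add_smul, map_add, map_add, hx, hy, add_smul]
    | smul r x hx => rw [smul_assoc, map_smul, map_smul, hx, smul_assoc]

/-- The restriction of `m ⊗ u ↦ d(m)(u)` to the kernel of the augmentation. -/
noncomputable def toAugHom (d : crossedHom ρ σ) :
    LinearMap.ker (augmentation ρ) →ₗ[k[M]] σ.asModule :=
  linearOfComm σ (W := LinearMap.ker (augmentation ρ))
    (linExt d.1 ∘ₗ LinearMap.restrictScalars k (LinearMap.ker (augmentation ρ)).subtype) fun m p => by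
    rw [LinearMap.comp_apply, LinearMap.comp_apply, LinearMap.restrictScalars_apply,
      LinearMap.restrictScalars_apply, Submodule.subtype_apply, Submodule.subtype_apply,
      Submodule.coe_smul, crossedHom.linExt_smul d, LinearMap.mem_ker.1 p.2, map_zero, map_zero,
      add_zero]

theorem toAugHom_apply (d : crossedHom ρ σ) (p : LinearMap.ker (augmentation ρ)) :
    toAugHom ρ σ d p = σ.asModuleEquiv.symm (linExt d.1 (p : k[M] ⊗[k] U)) := rfl

theorem toAugHom_toAugKer (d : crossedHom ρ σ) (m : M) (u : U) :
    toAugHom ρ σ d (toAugKer ρ (MonoidAlgebra.single m 1 ⊗ₜ u)) =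
      σ.asModuleEquiv.symm (d.1 m u) := by
  rw [toAugHom_apply, coe_toAugKer_single, map_sub, linExt_single, MonoidAlgebra.one_def,
    linExt_single, crossedHom.map_one, LinearMap.zero_apply, sub_zero]

/-- The crossed homomorphism is read off from `χ` on the generators `m ⊗ u - 1 ⊗ mu`. -/
theorem toAugHom_surjective : Function.Surjective (toAugHom ρ σ) := by
  intro χ
  let d : crossedHom ρ σ := ⟨fun m => σ.asModuleEquiv.toLinearMap ∘ₗ χ.restrictScalars k ∘ₗ
      toAugKer ρ ∘ₗ TensorProduct.mk k k[M] U (MonoidAlgebra.single m 1), fun m n => by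
    ext u
    change σ.asModuleEquiv (χ (toAugKer ρ (MonoidAlgebra.single (m * n) 1 ⊗ₜ u))) =
      σ m (σ.asModuleEquiv (χ (toAugKer ρ (MonoidAlgebra.single n 1 ⊗ₜ u)))) +
        σ.asModuleEquiv (χ (toAugKer ρ (MonoidAlgebra.single m 1 ⊗ₜ ρ n u)))
    rw [toAugKer_single_mul, map_add, map_add, map_smul, Representation.asModuleEquiv_map_smul,
      Representation.asAlgebraHom_single_one]⟩
  have hd : linExt d.1 = σ.asModuleEquiv.toLinearMap ∘ₗ χ.restrictScalars k ∘ₗ toAugKer ρ :=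
    linExt_unique fun m u => by rw [linExt_single]; rfl
  refine ⟨d, LinearMap.ext fun p => ?_⟩
  rw [toAugHom_apply, hd]
  change χ (toAugKer ρ p) = χ p
  rw [toAugKer_of_mem]

/-- A homomorphism on the kernel of the augmentation extends to the induced module exactly when
the crossed homomorphism is inner. -/
theorem exists_extension_iff (d : crossedHom ρ σ) :
    (∃ ψ : k[M] ⊗[k] U →ₗ[k[M]] σ.asModule,
      ψ ∘ₗ (LinearMap.ker (augmentation ρ)).subtype = toAugHom ρ σ d) ↔
      d ∈ LinearMap.range (innerHom ρ σ) := by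
  constructor
  · rintro ⟨ψ, hψ⟩
    refine ⟨σ.asModuleEquiv.toLinearMap ∘ₗ ψ.restrictScalars k ∘ₗ
      TensorProduct.mk k k[M] U 1, ?_⟩
    apply Subtype.ext
    ext m u
    have h := toAugHom_toAugKer ρ σ d m u
    rw [← hψ, LinearMap.comp_apply, Submodule.subtype_apply, coe_toAugKer_single, map_sub] at h
    rw [innerHom_apply]
    have h2 : ψ (MonoidAlgebra.single m 1 ⊗ₜ u) =
        MonoidAlgebra.single m (1 : k) • ψ (1 ⊗ₜ u) := by
      rw [← map_smul, TensorProduct.smul_tmul', smul_eq_mul, mul_one]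
    have h3 := congrArg σ.asModuleEquiv h
    rw [h2, map_sub, Representation.asModuleEquiv_map_smul,
      Representation.asAlgebraHom_single_one, LinearEquiv.apply_symm_apply] at h3
    exact h3
  · rintro ⟨φ, rfl⟩
    refine ⟨inducedLift σ φ, LinearMap.ext fun p => ?_⟩
    have h : linExt (innerHom ρ σ φ).1 = σ.asModuleEquiv.toLinearMap ∘ₗ
        (inducedLift σ φ).restrictScalars k ∘ₗ
          (LinearMap.ker (augmentation ρ)).subtype.restrictScalars k ∘ₗ toAugKer ρ := by
      apply linExt_unique
      intro m u
      rw [linExt_single, innerHom_apply]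
      change _ = σ.asModuleEquiv (inducedLift σ φ (toAugKer ρ (MonoidAlgebra.single m 1 ⊗ₜ u)))
      rw [coe_toAugKer_single, map_sub, inducedLift_single, MonoidAlgebra.one_def,
        inducedLift_single, map_one]
      rfl
    rw [toAugHom_apply, h]
    change inducedLift σ φ p = inducedLift σ φ (toAugKer ρ p)
    rw [toAugKer_of_mem]

end Resolution

end CrossedHom

/-! ### Counting arrows by crossed homomorphisms. -/

section NumArrows

variable {k : Type u} {M : Type v} [Field k] [Monoid M]
variable {U V : Type (max u v)} [AddCommGroup U] [Module k U] [AddCommGroup V] [Module k V]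
variable (ρ : Representation k M U) (σ : Representation k M V)

/-- `Ext¹(U, V)` is the space of crossed homomorphisms modulo the inner ones. -/
theorem exists_crossedHom_ext : ∃ q : crossedHom ρ σ →ₗ[k]
    Abelian.Ext.{max u v} (ModuleCat.of.{max u v} k[M] ρ.asModule)
      (ModuleCat.of.{max u v} k[M] σ.asModule) 1,
    Function.Surjective q ∧ LinearMap.ker q = LinearMap.range (innerHom ρ σ) := by
  obtain ⟨q, hq, h⟩ := exists_ext_of_presentation (k := k) (augmentation_surjective ρ)
    (toAugHom ρ σ)
    (fun d d' => LinearMap.ext fun p => by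
      change linExt (d.1 + d'.1) (p : k[M] ⊗[k] U) =
        linExt d.1 (p : k[M] ⊗[k] U) + linExt d'.1 (p : k[M] ⊗[k] U)
      rw [map_add]; rfl)
    (fun c d p => by
      change linExt (c • d.1) (p : k[M] ⊗[k] U) = algebraMap k k[M] c • toAugHom ρ σ d p
      rw [map_smul, algebraMap_smul]; rfl)
    (toAugHom_surjective ρ σ)
  refine ⟨q, hq, ?_⟩
  ext d
  rw [← exists_extension_iff, LinearMap.mem_ker, h]

/-- A complement of the inner crossed homomorphisms computes the number of arrows. -/
theorem numArrows_eq_rank {W : Type (max u v)} [AddCommGroup W] [Module k W]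
    (j : W →ₗ[k] crossedHom ρ σ) (hj : ∀ w, j w ∈ LinearMap.range (innerHom ρ σ) → w = 0)
    (hs : ∀ d, ∃ w φ, d = j w + innerHom ρ σ φ) : numArrows ρ σ = Module.rank k W := by
  obtain ⟨q, hq, hker⟩ := exists_crossedHom_ext ρ σ
  refine (LinearEquiv.rank_eq (LinearEquiv.ofBijective (q ∘ₗ j) ⟨?_, ?_⟩)).symm
  · rw [← LinearMap.ker_eq_bot, LinearMap.ker_eq_bot']
    intro w hw
    exact hj w (hker ▸ hw)
  · intro x
    obtain ⟨d, rfl⟩ := hq x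
    obtain ⟨w, φ, rfl⟩ := hs d
    refine ⟨w, ?_⟩
    have : q (innerHom ρ σ φ) = 0 := by
      rw [← LinearMap.mem_ker, hker]; exact ⟨φ, rfl⟩
    rw [map_add, this, add_zero]; rfl

theorem numArrows_eq_zero (h : ∀ d : crossedHom ρ σ, d ∈ LinearMap.range (innerHom ρ σ)) :
    numArrows ρ σ = 0 := by
  rw [numArrows_eq_rank ρ σ (W := PUnit) 0 (fun _ _ => rfl), rank_subsingleton']
  intro d
  obtain ⟨φ, hφ⟩ := h d
  exact ⟨0, φ, by rw [LinearMap.zero_apply, zero_add, hφ]⟩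

end NumArrows

/-! ### Full representations, scalar commutants and splitting fields. -/

section FullRepresentations

variable {k G U : Type*} [Field k] [Monoid G] [AddCommGroup U] [Module k U]

theorem isIrreducible_of_forall [Nontrivial U] (ρ : Representation k G U)
    (h : ∀ W : Submodule k U, (∀ g, ∀ w ∈ W, ρ g w ∈ W) → W ≠ ⊥ → W = ⊤) : ρ.IsIrreducible where
  exists_pair_ne := ⟨⊥, ⊤, fun h0 => bot_ne_top (α := Submodule k U)
    (congrArg Subrepresentation.toSubmodule h0)⟩
  eq_bot_or_eq_top W := by
    by_cases hW : W.toSubmodule = ⊥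
    · exact Or.inl (Subrepresentation.toSubmodule_injective hW)
    · exact Or.inr (Subrepresentation.toSubmodule_injective
        (h W.toSubmodule (fun g w hw => W.apply_mem_toSubmodule g hw) hW))

theorem nontrivial_of_isIrreducible {ρ : Representation k G U} (h : ρ.IsIrreducible) :
    Nontrivial U := by
  by_contra hU
  rw [not_nontrivial_iff_subsingleton] at hU
  obtain ⟨W, W', hW⟩ := h.exists_pair_ne
  exact hW (Subrepresentation.toSubmodule_injective (Subsingleton.elim _ _))

theorem eq_top_of_isIrreducible {ρ : Representation k G U} (h : ρ.IsIrreducible)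
    (W : Submodule k U) (hW : ∀ g, ∀ w ∈ W, ρ g w ∈ W) (h0 : W ≠ ⊥) : W = ⊤ := by
  rcases h.eq_bot_or_eq_top ⟨W, fun g w hw => hW g w hw⟩ with h1 | h1
  · exact absurd (congrArg Subrepresentation.toSubmodule h1) h0
  · exact congrArg Subrepresentation.toSubmodule h1

/-- A representation is full if its operators span the endomorphism algebra. -/
def IsFull (ρ : Representation k G U) : Prop := Submodule.span k (Set.range ρ) = ⊤

/-- The commutant of a representation consists of scalars. -/
def HasScalarCommutant (ρ : Representation k G U) : Prop :=
  ∀ φ : Module.End k U, (∀ g u, φ (ρ g u) = ρ g (φ u)) → ∃ c : k, ∀ u, φ u = c • u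

/-- The span contains the rank-one operator carrying a given nonzero vector `w` of the subspace to
any prescribed `x`. -/
theorem IsFull.isIrreducible [Nontrivial U] {ρ : Representation k G U} (h : IsFull ρ) :
    ρ.IsIrreducible := by
  refine isIrreducible_of_forall ρ fun W hW h0 => ?_
  obtain ⟨w, hw, hw0⟩ := W.ne_bot_iff.1 h0
  have key : ∀ A ∈ Submodule.span k (Set.range ρ), A w ∈ W := by
    intro A hA
    induction hA using Submodule.span_induction with
    | mem A hA => obtain ⟨g, rfl⟩ := hA; exact hW g w hw
    | zero => exact W.zero_mem
    | add A B _ _ hA hB => exact W.add_mem hA hB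
    | smul c A _ hA => exact W.smul_mem c hA
  rw [eq_top_iff]
  intro x _
  obtain ⟨f, hf⟩ := Module.Projective.exists_dual_eq_one k hw0
  have := key (f.smulRight x) (h ▸ Submodule.mem_top)
  rwa [LinearMap.smulRight_apply, hf, one_smul] at this

/-- An operator commuting with all rank-one operators `u ↦ f(u) x` is a scalar: with `f(w) = 1`,
evaluation at `w` gives `φ(x) = f(φ(w)) x`. -/
theorem IsFull.hasScalarCommutant {ρ : Representation k G U} (h : IsFull ρ) :
    HasScalarCommutant ρ := by
  intro φ hφ
  have key : ∀ A ∈ Submodule.span k (Set.range ρ), ∀ u, φ (A u) = A (φ u) := by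
    intro A hA
    induction hA using Submodule.span_induction with
    | mem A hA => obtain ⟨g, rfl⟩ := hA; exact hφ g
    | zero => intro u; simp
    | add A B _ _ hA hB => intro u; simp [hA, hB]
    | smul c A _ hA => intro u; simp [hA]
  rcases subsingleton_or_nontrivial U with hU | hU
  · exact ⟨0, fun u => Subsingleton.elim _ _⟩
  obtain ⟨w, hw⟩ := exists_ne (0 : U)
  obtain ⟨f, hf⟩ := Module.Projective.exists_dual_eq_one k hw
  refine ⟨f (φ w), fun x => ?_⟩
  have := key (f.smulRight x) (h ▸ Submodule.mem_top) w
  rwa [LinearMap.smulRight_apply, hf, one_smul, LinearMap.smulRight_apply] at this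

/-- Burnside's theorem for representations with scalar commutant. -/
theorem HasScalarCommutant.isFull [FiniteDimensional k U] {ρ : Representation k G U}
    (hc : HasScalarCommutant ρ) (h : ρ.IsIrreducible) : IsFull ρ := by
  classical
  rw [IsFull, eq_top_iff]
  intro f _
  have : IsSimpleModule k[G] ρ.asModule := (ρ.irreducible_iff_isSimpleModule_asModule).1 h
  -- The module endomorphisms are scalars, so every `k`-linear `f` commutes with them, and Jacobson
  -- density realises `f` on a basis by an element of `k[G]`.
  let f' : Module.End (Module.End k[G] ρ.asModule) ρ.asModule :=
    { toFun := fun u => ρ.asModuleEquiv.symm (f (ρ.asModuleEquiv u))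
      map_add' := fun u v => by rw [map_add, map_add, map_add]
      map_smul' := fun φ u => by
        obtain ⟨c, hφ⟩ := hc (ρ.asModuleEquiv.toLinearMap ∘ₗ φ.restrictScalars k ∘ₗ
          ρ.asModuleEquiv.symm.toLinearMap) (fun g u => by
            change ρ.asModuleEquiv (φ (ρ.asModuleEquiv.symm (ρ g u))) = _
            rw [Representation.asModuleEquiv_symm_map_rho, map_smul,
              Representation.asModuleEquiv_map_smul, MonoidAlgebra.of_apply,
              Representation.asAlgebraHom_single_one]
            rfl)
        have hφ' : ∀ u : ρ.asModule, φ u = ρ.asModuleEquiv.symm (c • ρ.asModuleEquiv u) :=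
          fun u => hφ (ρ.asModuleEquiv u)
        rw [Module.End.smul_def, hφ', RingHom.id_apply, Module.End.smul_def, hφ',
          LinearEquiv.apply_symm_apply, LinearEquiv.apply_symm_apply, map_smul] }
  let b := Module.finBasis k U
  obtain ⟨r, hr⟩ := jacobson_density f'
    (Finset.univ.image fun i => ρ.asModuleEquiv.symm (b i))
  have hf : f = ρ.asAlgebraHom r := by
    apply b.ext
    intro i
    have := hr (ρ.asModuleEquiv.symm (b i))
      (Finset.mem_image_of_mem _ (Finset.mem_univ i))
    exact congrArg ρ.asModuleEquiv this
  rw [hf]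
  clear hr hf
  induction r using MonoidAlgebra.induction_linear with
  | zero => rw [map_zero]; exact Submodule.zero_mem _
  | add x y hx hy => rw [map_add]; exact Submodule.add_mem _ (hx) (hy)
  | single g c =>
    rw [Representation.asAlgebraHom_single]
    exact Submodule.smul_mem _ _ (Submodule.subset_span ⟨g, rfl⟩)

/-- Irreducible representations over a splitting field have scalar commutant. -/
theorem IsSplittingField.hasScalarCommutant (hk : IsSplittingField k G)
    {ρ : Representation k G U} (h : ρ.IsIrreducible) : HasScalarCommutant ρ := by
  classical
  intro φ hφ
  obtain ⟨n, d, ⟨e⟩⟩ := hk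
  have hS : IsSimpleModule k[G] ρ.asModule := (ρ.irreducible_iff_isSimpleModule_asModule).1 h
  have hU := nontrivial_of_isIrreducible h
  let π : k[G] →ₐ[k] (∀ i, Matrix (Fin (d i)) (Fin (d i)) k) :=
    e.toAlgHom.comp (Ideal.Quotient.mkₐ k (Ring.jacobson k[G]))
  have hπ : Function.Surjective π := e.surjective.comp (Ideal.Quotient.mkₐ_surjective k _)
  -- The radical annihilates simple modules, so the action depends only on the image in the product
  -- of matrix algebras.
  have hker : ∀ a, π a = 0 → ρ.asAlgebraHom a = 0 := by
    intro a ha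
    have ha' : a ∈ Ring.jacobson k[G] :=
      Ideal.Quotient.eq_zero_iff_mem.1 ((map_eq_zero_iff e e.injective).1 ha)
    ext u
    exact Module.mem_annihilator.1
      (IsSemisimpleModule.jacobson_le_annihilator k[G] ρ.asModule ha') (ρ.asModuleEquiv.symm u)
  have heq : ∀ a b, π a = π b → ρ.asAlgebraHom a = ρ.asAlgebraHom b := fun a b hab => by
    rw [← sub_eq_zero, ← map_sub]; exact hker _ (by rw [map_sub, hab, sub_self])
  have hcomm : ∀ a u, φ (ρ.asAlgebraHom a u) = ρ.asAlgebraHom a (φ u) := by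
    intro a
    induction a using MonoidAlgebra.induction_linear with
    | zero => intro u; simp
    | add x y hx hy => intro u; simp [hx, hy]
    | single g c => intro u; simp [Representation.asAlgebraHom_single, hφ]
  -- Lifts of the diagonal matrix units. Their images sum to `1`, so at least one of them acts
  -- nontrivially.
  choose a ha using fun ij : (Σ i, Fin (d i)) =>
    hπ (Pi.single ij.1 (Matrix.single ij.2 ij.2 1))
  have hsum : ρ.asAlgebraHom (∑ ij, a ij) = 1 := by
    rw [← map_one ρ.asAlgebraHom]
    apply heq
    rw [map_sum, map_one, Fintype.sum_sigma]
    simp only [ha]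
    have : ∀ i, ∑ j : Fin (d i), (Pi.single i (Matrix.single j j 1) :
        ∀ i, Matrix (Fin (d i)) (Fin (d i)) k) = Pi.single i 1 := fun i => by
      rw [← Matrix.sum_single_one]
      exact (map_sum (AddMonoidHom.single (fun i => Matrix (Fin (d i)) (Fin (d i)) k) i) _ _).symm
    rw [Finset.sum_congr rfl fun i _ => this i]
    exact Finset.univ_sum_single (1 : ∀ i, Matrix (Fin (d i)) (Fin (d i)) k)
  obtain ⟨ij, hij⟩ : ∃ ij, ρ.asAlgebraHom (a ij) ≠ 0 := by
    by_contra! h0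
    rw [map_sum, Finset.sum_eq_zero fun ij _ => h0 ij] at hsum
    exact zero_ne_one hsum
  obtain ⟨s, hs⟩ : ∃ s, ρ.asAlgebraHom (a ij) s ≠ 0 := by
    by_contra! h0
    exact hij (LinearMap.ext h0)
  -- The corner cut out by a diagonal matrix unit is one-dimensional over `k`; this is where
  -- splitting enters. Consequently `φ` acts by a scalar on a nonzero vector `t` of the image of
  -- this idempotent.
  have hcorner : ∀ r, ∃ c : k, ρ.asAlgebraHom (a ij * r * a ij) = c • ρ.asAlgebraHom (a ij) := by
    intro r
    refine ⟨π r ij.1 ij.2 ij.2, ?_⟩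
    rw [← map_smul]
    apply heq
    rw [map_mul, map_mul, ha, map_smul, ha]
    ext1 i
    rw [Pi.mul_apply, Pi.mul_apply, Pi.smul_apply]
    by_cases hi : i = ij.1
    · subst hi
      rw [Pi.single_eq_same, Matrix.single_mul_mul_single, Matrix.smul_single]
      simp
    · rw [Pi.single_eq_of_ne hi, zero_mul, mul_zero, smul_zero]
  have hidem : ρ.asAlgebraHom (a ij * a ij) = ρ.asAlgebraHom (a ij) := by
    apply heq
    rw [map_mul, ha, ← Pi.single_mul, Matrix.single_mul_single_same, mul_one]
  set t := ρ.asAlgebraHom (a ij) s with ht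
  have htt : ρ.asAlgebraHom (a ij) t = t := by
    rw [ht, ← Module.End.mul_apply, ← map_mul, hidem]
  obtain ⟨r, hr⟩ := (isSimpleModule_iff_toSpanSingleton_surjective.1 hS).2
    (ρ.asModuleEquiv.symm t) hs (ρ.asModuleEquiv.symm (φ t))
  have hr' : ρ.asAlgebraHom r t = φ t := hr
  obtain ⟨c, hc⟩ := hcorner r
  have hφt : φ t = c • t := by
    calc φ t = ρ.asAlgebraHom (a ij) (φ t) := by rw [← hcomm, htt]
      _ = ρ.asAlgebraHom (a ij * r * a ij) t := by
        rw [← hr', map_mul, map_mul, Module.End.mul_apply, Module.End.mul_apply, htt]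
      _ = c • t := by rw [hc, LinearMap.smul_apply, htt]
  refine ⟨c, fun u => ?_⟩
  -- The kernel of `φ - c` is invariant and contains `t ≠ 0`.
  have htop : LinearMap.ker (φ - c • LinearMap.id) = ⊤ := by
    refine eq_top_of_isIrreducible h _ (fun g w hw => ?_) fun h0 => hs ?_
    · rw [LinearMap.mem_ker, LinearMap.sub_apply, LinearMap.smul_apply, LinearMap.id_apply,
        sub_eq_zero] at hw ⊢
      rw [hφ, hw, map_smul]
    · rw [← Submodule.mem_bot k, ← h0, LinearMap.mem_ker, LinearMap.sub_apply,
        LinearMap.smul_apply, LinearMap.id_apply, ← hφt, sub_self]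
  have hu : u ∈ LinearMap.ker (φ - c • LinearMap.id) := htop ▸ Submodule.mem_top
  rwa [LinearMap.mem_ker, LinearMap.sub_apply, LinearMap.smul_apply, LinearMap.id_apply,
    sub_eq_zero] at hu

/-- The finite orbit of a nonzero vector spans an invariant subspace, hence everything. -/
theorem finiteDimensional_of_isIrreducible [Finite G] {ρ : Representation k G U}
    (h : ρ.IsIrreducible) : FiniteDimensional k U := by
  have hU := nontrivial_of_isIrreducible h
  obtain ⟨w, hw⟩ := exists_ne (0 : U)
  have htop : Submodule.span k (Set.range fun g => ρ g w) = ⊤ := by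
    refine eq_top_of_isIrreducible h _ (fun g u hu => ?_) fun h0 => hw ?_
    · induction hu using Submodule.span_induction with
      | mem x hx =>
        obtain ⟨g', rfl⟩ := hx
        exact Submodule.subset_span ⟨g * g', by simp [map_mul]⟩
      | zero => rw [map_zero]; exact Submodule.zero_mem _
      | add x y _ _ hx hy => rw [map_add]; exact Submodule.add_mem _ hx hy
      | smul c x _ hx => rw [map_smul]; exact Submodule.smul_mem _ c hx
    · rw [← Submodule.mem_bot k, ← h0]
      exact Submodule.subset_span ⟨1, by simp⟩
  exact Module.finite_def.2 (htop ▸ Submodule.fg_span (Set.finite_range _))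

end FullRepresentations

/-! ### Duals and outer tensor products of full representations. -/

section Tensor

variable {k G H U V : Type*} [Field k] [AddCommGroup U] [Module k U] [AddCommGroup V] [Module k V]

/-- The preimage of `f` is the transpose of `f` restricted along `U → U**`, followed by `V** ≃ V`.
-/
theorem transpose_surjective [FiniteDimensional k V] :
    Function.Surjective (Module.Dual.transpose (R := k) (M := U) (M' := V)) := by
  intro f
  refine ⟨(Module.evalEquiv k V).symm.toLinearMap ∘ₗ f.dualMap ∘ₗ Module.Dual.eval k U, ?_⟩
  ext φ u
  change φ ((Module.evalEquiv k V).symm (f.dualMap (Module.Dual.eval k U u))) = f φ u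
  rw [Module.apply_evalEquiv_symm_apply]
  rfl

theorem transpose_injective :
    Function.Injective (Module.Dual.transpose (R := k) (M := U) (M' := V)) := by
  intro f g h
  ext u
  rw [← sub_eq_zero, ← Module.forall_dual_apply_eq_zero_iff k]
  intro φ
  rw [map_sub, sub_eq_zero]
  exact LinearMap.congr_fun (LinearMap.congr_fun h φ) u

theorem span_range_transpose [FiniteDimensional k U] {S : Set (Module.End k U)}
    (h : Submodule.span k S = ⊤) :
    Submodule.span k ((fun f => (f.dualMap : Module.End k (Module.Dual k U))) '' S) = ⊤ := by
  change Submodule.span k (Module.Dual.transpose '' S) = ⊤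
  rw [← Submodule.map_span, h, Submodule.map_top, LinearMap.range_eq_top.2 transpose_surjective]

theorem IsFull.dual [Group G] [FiniteDimensional k U] {ρ : Representation k G U} (h : IsFull ρ) :
    IsFull ρ.dual := by
  have := span_range_transpose h
  rw [IsFull, eq_top_iff, ← this]
  refine Submodule.span_mono ?_
  rintro _ ⟨_, ⟨g, rfl⟩, rfl⟩
  refine ⟨g⁻¹, ?_⟩
  ext φ u
  rw [Representation.dual_apply, inv_inv]
  rfl

/-- Every endomorphism of `U ⊗ V` is a sum of maps `A ⊗ B`, and each of `A`, `B` is a combination of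
group operators. -/
theorem IsFull.tprod [Monoid G] [Monoid H] [FiniteDimensional k U] [FiniteDimensional k V]
    {ρ : Representation k G U} {σ : Representation k H V} (hρ : IsFull ρ) (hσ : IsFull σ) :
    IsFull (Representation.tprod (ρ.comp (MonoidHom.fst G H)) (σ.comp (MonoidHom.snd G H))) := by
  rw [IsFull, eq_top_iff]
  intro f _
  obtain ⟨x, rfl⟩ := (homTensorHomEquiv k U V U V).surjective f
  rw [homTensorHomEquiv_apply]
  induction x using TensorProduct.induction_on with
  | zero => rw [map_zero]; exact Submodule.zero_mem _
  | add x y hx hy => rw [map_add]; exact Submodule.add_mem _ (hx trivial) (hy trivial)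
  | tmul A B =>
    have h : TensorProduct.map A B ∈ Submodule.map₂ (TensorProduct.mapBilinear (RingHom.id k) U V U V)
        (Submodule.span k (Set.range ρ)) (Submodule.span k (Set.range σ)) :=
      Submodule.apply_mem_map₂ _ (hρ ▸ Submodule.mem_top) (hσ ▸ Submodule.mem_top)
    rw [Submodule.map₂_span_span] at h
    refine Submodule.span_mono ?_ h
    rintro _ ⟨_, ⟨g, rfl⟩, _, ⟨h, rfl⟩, rfl⟩
    exact ⟨(g, h), rfl⟩

end Tensor

/-! ### Multiplicities as dimensions of spaces of homomorphisms. -/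

section Multiplicity

variable {k A T Ω : Type*} [Field k] [Ring A] [Algebra k A]
  [AddCommGroup T] [Module A T]
  [AddCommGroup Ω] [Module k Ω] [Module A Ω] [IsScalarTower k A Ω]

/-- Schur's lemma and additivity: the dimension of `Hom(T, Ω)` counts the simple summands of `T`
isomorphic to `Ω`. -/
theorem rank_hom_eq_card [IsSimpleModule A Ω]
    (hc : ∀ φ : Ω →ₗ[A] Ω, ∃ c : k, ∀ x, φ x = c • x) {m : ℕ} (S : Fin m → Submodule A T)
    (hS : DirectSum.IsInternal S) (hs : ∀ i, IsSimpleModule A (S i)) :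
    Module.rank k (T →ₗ[A] Ω) = Nat.card {i // Nonempty (S i ≃ₗ[A] Ω)} := by
  classical
  have : Nontrivial Ω := IsSimpleModule.nontrivial A Ω
  obtain ⟨w, hw⟩ := exists_ne (0 : Ω)
  obtain ⟨l, hl⟩ := Module.Projective.exists_dual_eq_one k hw
  choose θ hθ using fun i : {i // Nonempty (S i ≃ₗ[A] Ω)} =>
    (⟨i.2.some, trivial⟩ : ∃ _ : S i ≃ₗ[A] Ω, True)
  let D : DirectSum _ (fun i => S i) ≃ₗ[A] T := LinearEquiv.ofBijective (DirectSum.coeLinearMap S) hS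
  have hD : ∀ i (x : S i), D.symm x = DirectSum.lof A _ (fun i => S i) i x := fun i x => by
    rw [LinearEquiv.symm_apply_eq]
    exact (DirectSum.coeLinearMap_lof S i x).symm
  -- On a summand identified with `Ω`, a homomorphism is a scalar by `hc`; since `l w = 1`,
  -- evaluating at `w` and applying `l` recovers that scalar. On the other summands it vanishes by
  -- Schur's lemma.
  let Ψ : (T →ₗ[A] Ω) →ₗ[k] ({i // Nonempty (S i ≃ₗ[A] Ω)} → k) :=
    { toFun := fun f i => l (f ((θ i).symm w))
      map_add' := fun f g => by ext i; simp
      map_smul' := fun c f => by ext i; simp }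
  have hinj : Function.Injective Ψ := by
    rw [← LinearMap.ker_eq_bot, LinearMap.ker_eq_bot']
    intro f hf
    have hz : ∀ i, ∀ x ∈ S i, f x = 0 := by
      intro i x hx
      by_cases hi : Nonempty (S i ≃ₗ[A] Ω)
      · obtain ⟨c, hcf⟩ := hc (f ∘ₗ (S i).subtype ∘ₗ (θ ⟨i, hi⟩).symm.toLinearMap)
        have h0 : c = 0 := by
          have h1 : l (f ((θ ⟨i, hi⟩).symm w)) = 0 := congrFun hf ⟨i, hi⟩
          have h2 : f ((θ ⟨i, hi⟩).symm w) = c • w := hcf w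
          rwa [h2, map_smul, hl, smul_eq_mul, mul_one] at h1
        have h3 := hcf (θ ⟨i, hi⟩ ⟨x, hx⟩)
        rw [h0, zero_smul, LinearMap.comp_apply, LinearMap.comp_apply, LinearEquiv.coe_coe,
          LinearEquiv.symm_apply_apply] at h3
        exact h3
      · rcases LinearMap.bijective_or_eq_zero (f ∘ₗ (S i).subtype) with h | h
        · exact absurd ⟨LinearEquiv.ofBijective _ h⟩ hi
        · exact LinearMap.congr_fun h ⟨x, hx⟩
    have htop : (⊤ : Submodule A T) ≤ LinearMap.ker f := by
      rw [← hS.submodule_iSup_eq_top]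
      exact iSup_le hz
    exact LinearMap.ext fun x => htop Submodule.mem_top
  have hsurj : Function.Surjective Ψ := by
    intro c
    refine ⟨DirectSum.toModule A _ Ω (fun i => if hi : Nonempty (S i ≃ₗ[A] Ω) then
      c ⟨i, hi⟩ • (θ ⟨i, hi⟩).toLinearMap else 0) ∘ₗ D.symm.toLinearMap, ?_⟩
    ext i
    change l (DirectSum.toModule A _ Ω _ (D.symm ((θ i).symm w : S i))) = c i
    rw [hD, DirectSum.toModule_lof, dif_pos i.2, LinearMap.smul_apply, LinearEquiv.coe_coe,
      LinearEquiv.apply_symm_apply, map_smul, hl, smul_eq_mul, mul_one]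
  have hr := LinearEquiv.lift_rank_eq (LinearEquiv.ofBijective Ψ ⟨hinj, hsurj⟩)
  rw [rank_fun', Cardinal.lift_natCast, Cardinal.lift_eq_nat_iff] at hr
  rw [hr, Nat.card_eq_fintype_card]

theorem exists_isInternal_simple [IsNoetherian A T] [IsSemisimpleModule A T] :
    ∃ (m : ℕ) (S : Fin m → Submodule A T), DirectSum.IsInternal S ∧
      ∀ i, IsSimpleModule A (S i) := by
  obtain ⟨s, hind, hsup, hs⟩ := IsSemisimpleModule.exists_sSupIndep_sSup_simples_eq_top A T
  have hfin : Finite s := WellFoundedGT.finite_of_iSupIndep ((sSupIndep_iff _).1 hind) fun S =>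
    (S.1.nontrivial_iff_ne_bot).1 (have := hs S.1 S.2; IsSimpleModule.nontrivial A S.1)
  let e := (Finite.equivFin s).symm
  refine ⟨Nat.card s, fun i => (e i).1, ?_, fun i => hs _ (e i).2⟩
  apply DirectSum.isInternal_submodule_of_iSupIndep_of_iSup_eq_top
  · exact ((sSupIndep_iff _).1 hind).comp e.injective
  · rw [e.iSup_comp (g := fun S : s => S.1), ← hsup, sSup_eq_iSup']

/-- The multiplicity of an irreducible representation with scalar commutant is the dimension of
the space of intertwining maps. -/
theorem exists_hasMultiplicity {G W R : Type*} [Group G] [Finite G] [AddCommGroup W] [Module k W]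
    [AddCommGroup R] [Module k R] [FiniteDimensional k R] (hG : (Nat.card G : k) ≠ 0)
    {ω : Representation k G W} (hω : ω.IsIrreducible) (hc : HasScalarCommutant ω)
    (τ : Representation k G R) : ∃ n : ℕ, HasMultiplicity ω τ n ∧
      Module.rank k (Representation.IntertwiningMap τ ω) = n := by
  have : NeZero (Nat.card G : k) := ⟨hG⟩
  have : IsSimpleModule k[G] ω.asModule := (ω.irreducible_iff_isSimpleModule_asModule).1 hω
  have : IsNoetherian k[G] τ.asModule := isNoetherian_of_tower k (inferInstanceAs (IsNoetherian k R))
  obtain ⟨m, S, hS, hs⟩ := exists_isInternal_simple (A := k[G]) (T := τ.asModule)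
  refine ⟨_, ⟨m, S, hS, hs, rfl⟩, ?_⟩
  rw [(Representation.IntertwiningMap.equivLinearMapAsModule τ ω).rank_eq,
    rank_hom_eq_card _ S hS hs]
  intro φ
  have h := hc ((Representation.IntertwiningMap.equivLinearMapAsModule ω ω).symm φ).toLinearMap
    fun g u => Representation.IntertwiningMap.isIntertwining _ _ _ g u
  exact h

end Multiplicity

/-! ### Ideals and idempotents in orthogroups. -/

section Orthogroups

variable {M : Type v} [Monoid M]

theorem mem_twoSided_trans {a b c : M} (h : a ∈ twoSided b) (h' : b ∈ twoSided c) :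
    a ∈ twoSided c :=
  twoSided_subset_iff.2 h' h

theorem IsOrthogroup.exists_idempotent (hM : IsOrthogroup M) (m : M) :
    ∃ f, IsIdempotentElem f ∧ twoSided f = twoSided m := by
  obtain ⟨n, hn⟩ := hM.regular m
  refine ⟨m * n, ?_, twoSided_eq ⟨1, n, by rw [one_mul]⟩ ⟨1, m, by rw [one_mul, ← hn]⟩⟩
  change m * n * (m * n) = m * n
  rw [← mul_assoc, ← hn]

/-- Regularity replaces `a` by an idempotent generating the same ideal, which reduces the claim to
the rectangular case. -/
theorem IsOrthogroup.mul_mem (hM : IsOrthogroup M) {a m n : M} (hm : a ∈ twoSided m)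
    (hn : a ∈ twoSided n) : a ∈ twoSided (m * n) := by
  obtain ⟨f, hf, hfa⟩ := hM.exists_idempotent a
  have ha : a ∈ twoSided f := hfa ▸ mem_twoSided_self a
  have hf' : f ∈ twoSided a := hfa ▸ mem_twoSided_self f
  exact mem_twoSided_trans ha
    (hM.rectangular.mul_mem hf (mem_twoSided_trans hf' hm) (mem_twoSided_trans hf' hn))

/-- Closure of `M_X` under products is `IsOrthogroup.mul_mem`. Thus `Λ(M)` consists of all principal
ideals, and the supports in relations (a) and (b) become principal ideals. -/
theorem IsOrthogroup.isPrimary (hM : IsOrthogroup M) (m : M) : IsPrimary (twoSided m) := by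
  refine ⟨⟨m, rfl⟩, ⟨⟨⟨above (twoSided m), fun {a b} ha hb => ?_⟩, ?_⟩, rfl⟩⟩
  · exact twoSided_subset_iff.2 (hM.mul_mem (twoSided_subset_iff.1 ha) (twoSided_subset_iff.1 hb))
  · exact twoSided_subset_iff.2 ⟨m, 1, by simp⟩

theorem IsOrthogroup.support_eq (hM : IsOrthogroup M) (m : M) : support m = twoSided m :=
  (Set.sUnion_subset fun _ hX => hX.2).antisymm
    (Set.subset_sUnion_of_mem ⟨hM.isPrimary m, subset_rfl⟩)

theorem IsOrthogroup.op (hM : IsOrthogroup M) : IsOrthogroup Mᵐᵒᵖ where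
  regular m := by
    obtain ⟨n, hn⟩ := hM.regular m.unop
    exact ⟨MulOpposite.op n, MulOpposite.unop_injective (by simpa [mul_assoc] using hn)⟩
  rectangular := hM.rectangular.op

variable [Finite M]

/-- In a single `𝒥`-class, an idempotent factor can be inserted in a product. -/
theorem IsOrthogroup.mul_idem_mul (hM : IsOrthogroup M) {e p q : M} (he : IsIdempotentElem e)
    (hp : twoSided p = twoSided e) (hq : twoSided q = twoSided e) : p * e * q = p * q := by
  obtain ⟨n, hn⟩ := hM.regular p
  obtain ⟨n', hn'⟩ := hM.regular q
  have hf : IsIdempotentElem (n * p) := by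
    change n * p * (n * p) = n * p
    rw [mul_assoc, ← mul_assoc p, ← hn]
  have hg : IsIdempotentElem (q * n') := by
    change q * n' * (q * n') = q * n'
    rw [← mul_assoc, ← hn']
  have hfe : twoSided (n * p) = twoSided e := by
    rw [← hp]
    exact twoSided_eq ⟨n, 1, by rw [mul_one]⟩ ⟨p, 1, by rw [mul_one, ← mul_assoc, ← hn]⟩
  have hge : twoSided (q * n') = twoSided e := by
    rw [← hq]
    exact twoSided_eq ⟨1, n', by rw [one_mul]⟩ ⟨1, q, by rw [one_mul, ← hn']⟩
  -- For the idempotents `f = np` and `g = qn'` in the class of `e`: write `g = gfg`, then collapse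
  -- `f(eg)f = f`.
  have h1 : n * p * e * (q * n') = n * p * (q * n') := by
    obtain ⟨ha, hb⟩ := hM.rectangular e (q * n') he hg hge.symm
    calc n * p * e * (q * n') = n * p * e * (q * n' * (n * p) * (q * n')) := by
          rw [hM.rectangular.sandwich hg hf (hge.trans hfe.symm)]
      _ = n * p * (e * (q * n')) * (n * p) * (q * n') := by simp only [mul_assoc]
      _ = n * p * (q * n') := by rw [hM.rectangular.sandwich hf ha (hfe.trans hb.symm)]
  calc p * e * q = p * n * p * e * (q * n' * q) := by rw [← hn, ← hn']
    _ = p * (n * p * e * (q * n')) * q := by simp only [mul_assoc]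
    _ = p * n * p * (q * n' * q) := by rw [h1]; simp only [mul_assoc]
    _ = p * q := by rw [← hn, ← hn']

theorem exists_isIdempotentElem_pow (p : M) : ∃ j : ℕ, IsIdempotentElem (p ^ (j + 1)) := by
  obtain ⟨a, b, hab, h⟩ := Finite.exists_ne_map_eq_of_infinite fun n : ℕ => p ^ n
  wlog hlt : a < b generalizing a b
  · exact this b a hab.symm h.symm (lt_of_le_of_ne (not_lt.1 hlt) hab.symm)
  obtain ⟨c, rfl⟩ := Nat.exists_eq_add_of_lt hlt
  change p ^ a = p ^ (a + c + 1) at h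
  have h1 : ∀ i n, a ≤ n → p ^ n = p ^ (n + i * (c + 1)) := by
    intro i n hn
    induction i with
    | zero => simp
    | succ i ih =>
      obtain ⟨r, rfl⟩ := Nat.exists_eq_add_of_le hn
      rw [ih, show a + r + i * (c + 1) = a + (r + i * (c + 1)) by ring, pow_add, h, ← pow_add]
      congr 1; ring
  -- Powers from exponent `a` on have period `c + 1`. The exponent `(a + 1)(c + 1)` is a multiple of
  -- the period and at least `a`, so doubling it changes nothing; the `- 1` offsets the form `j +
  -- 1`.
  refine ⟨(a + 1) * (c + 1) - 1, ?_⟩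
  have h2 : (a + 1) * (c + 1) - 1 + 1 = (a + 1) * (c + 1) :=
    Nat.sub_add_cancel (Nat.mul_pos a.succ_pos c.succ_pos)
  change p ^ _ * p ^ _ = p ^ _
  rw [h2, ← pow_add]
  exact (h1 (a + 1) ((a + 1) * (c + 1)) (by nlinarith)).symm

/-- Every element has an idempotent power, which generates the same ideal and acts as a left
identity. -/
theorem IsOrthogroup.exists_idempotent_pow (hM : IsOrthogroup M) (p : M) :
    ∃ j : ℕ, IsIdempotentElem (p ^ (j + 1)) ∧ twoSided (p ^ (j + 1)) = twoSided p ∧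
      p ^ (j + 1) * p = p := by
  obtain ⟨j, hj⟩ := exists_isIdempotentElem_pow p
  have hJ : twoSided (p ^ (j + 1)) = twoSided p := by
    refine twoSided_eq ⟨p ^ j, 1, by rw [pow_succ, mul_one]⟩ ?_
    clear hj
    induction j with
    | zero => rw [zero_add, pow_one]; exact mem_twoSided_self p
    | succ j ih => rw [pow_succ]; exact hM.mul_mem ih (mem_twoSided_self p)
  refine ⟨j, hj, hJ, ?_⟩
  obtain ⟨n, hn⟩ := hM.regular p
  have hg : IsIdempotentElem (p * n) := by
    change p * n * (p * n) = p * n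
    rw [← mul_assoc, ← hn]
  have hgp : twoSided (p * n) = twoSided p :=
    twoSided_eq ⟨1, n, by rw [one_mul]⟩ ⟨1, p, by rw [one_mul, ← hn]⟩
  -- With `g = pn` and `f` the idempotent power: `gfg = g` and `gf = f` give `fg = g`, hence `fp =
  -- fgp = gp = p`.
  have h1 := hM.rectangular.sandwich hg hj (hgp.trans hJ.symm)
  have h2 : p * n * p ^ (j + 1) = p ^ (j + 1) := by rw [pow_succ', ← mul_assoc, ← hn]
  rw [h2] at h1
  calc p ^ (j + 1) * p = p ^ (j + 1) * (p * n) * p := by rw [mul_assoc (p ^ (j + 1)), ← hn]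
    _ = p := by rw [h1, ← hn]

theorem IsOrthogroup.idempotent_eq (hM : IsOrthogroup M) {e f : M} (he : IsIdempotentElem e)
    (hf : IsIdempotentElem f) (hJ : twoSided e = twoSided f) (h1 : f * e = e) (h2 : e * f = e) :
    e = f := by
  have := hM.rectangular.sandwich hf he hJ.symm
  rwa [h1, h2] at this

theorem exists_maxSubgroup (hM : IsRectangular M) {e : M} (he : IsIdempotentElem e) {m : M}
    (hm : e ∈ twoSided m) : ∃ g : MaxSubgroup he, g.val = e * m * e :=
  ⟨retract hM he m (twoSided_subset_iff.2 hm), val_retract hM he m _⟩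

end Orthogroups

/-! ### Representations of maximal subgroups as representations of `M`. -/

section Inflation

variable {k : Type u} {M : Type v} [Field k] [Monoid M] [Finite M]
variable {U : Type w} [AddCommGroup U] [Module k U]

theorem MaxSubgroup.mem_twoSided {e : M} {he : IsIdempotentElem e} (g : MaxSubgroup he) :
    e ∈ twoSided g.val := ⟨1, (g⁻¹).val, by rw [one_mul, g.mul_inv_val]⟩

theorem inflate_of_notMem (hM : IsRectangular M) {e : M} {he : IsIdempotentElem e}
    (ρ : Representation k (MaxSubgroup he) U) {m : M} (hm : e ∉ twoSided m) :
    inflate hM ρ m = 0 :=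
  dif_neg fun h => hm (twoSided_subset_iff.1 h)

theorem inflate_val (hM : IsRectangular M) {e : M} {he : IsIdempotentElem e}
    (ρ : Representation k (MaxSubgroup he) U) (g : MaxSubgroup he) :
    inflate hM ρ g.val = ρ g := by
  have h : g.val ∈ above (twoSided e) := twoSided_subset_iff.2 g.mem_twoSided
  refine (dif_pos h).trans ?_
  congr 1
  apply MaxSubgroup.ext
  rw [val_retract hM he g.val h, g.left_mul, g.mul_right]

theorem inflate_idem (hM : IsRectangular M) {e : M} {he : IsIdempotentElem e}
    (ρ : Representation k (MaxSubgroup he) U) : inflate hM ρ e = 1 := by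
  have := inflate_val hM ρ 1
  rwa [MaxSubgroup.val_one, map_one] at this

/-- Since `e` acts as the identity, `m` acts like `eme`. Up to the zero operator, `M` and `G_e`
therefore act by the same operators, so irreducibility and commutants can be transferred. -/
theorem exists_inflate_eq (hM : IsRectangular M) {e : M} {he : IsIdempotentElem e}
    (ρ : Representation k (MaxSubgroup he) U) (m : M) :
    inflate hM ρ m = 0 ∨ ∃ g : MaxSubgroup he, inflate hM ρ m = ρ g := by
  by_cases hm : e ∈ twoSided m
  · obtain ⟨g, hg⟩ := exists_maxSubgroup hM he hm
    right
    refine ⟨g, ?_⟩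
    rw [← inflate_val hM ρ g, hg, map_mul, map_mul, inflate_idem, one_mul, mul_one]
  · exact Or.inl (inflate_of_notMem hM ρ hm)

theorem inflate_isIrreducible (hM : IsRectangular M) {e : M} {he : IsIdempotentElem e}
    {ρ : Representation k (MaxSubgroup he) U} (hρ : ρ.IsIrreducible) :
    (inflate hM ρ).IsIrreducible := by
  have := nontrivial_of_isIrreducible hρ
  refine isIrreducible_of_forall _ fun W hW h0 => eq_top_of_isIrreducible hρ W (fun g w hw => ?_) h0
  rw [← inflate_val hM ρ g]
  exact hW _ w hw

/-- Irreducible representations of maximal subgroups are full, over a splitting field. -/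
theorem IsSplittingField.isFull (hk : IsSplittingField k M) (hM : IsRectangular M) {e : M}
    {he : IsIdempotentElem e} {ρ : Representation k (MaxSubgroup he) U} (hρ : ρ.IsIrreducible) :
    IsFull ρ := by
  have := finiteDimensional_of_isIrreducible hρ
  refine HasScalarCommutant.isFull (fun φ hφ => ?_) hρ
  refine hk.hasScalarCommutant (inflate_isIrreducible hM hρ) φ fun m u => ?_
  rcases exists_inflate_eq hM ρ m with h | ⟨g, h⟩
  · rw [h, LinearMap.zero_apply, LinearMap.zero_apply, map_zero]
  · rw [h, hφ]

end Inflation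

/-! ### Crossed homomorphisms that are forced to be inner. -/

section Vanishing

variable {k : Type u} {M : Type v} [Field k] [Monoid M]
variable {U V : Type w} [AddCommGroup U] [Module k U] [AddCommGroup V] [Module k V]
variable {ρ : Representation k M U} {σ : Representation k M V}

/-- Expand `d` on `z = z(nz)`: one term contains `σ z`, the other contains `ρ z`. -/
theorem crossedHom_eq_zero (hM : IsOrthogroup M) (d : crossedHom ρ σ) {z : M}
    (h : ρ z = 0) (h' : σ z = 0) : d.1 z = 0 := by
  obtain ⟨n, hn⟩ := hM.regular z
  rw [hn, mul_assoc, d.2, h', map_mul, h, mul_zero, LinearMap.zero_comp, LinearMap.comp_zero,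
    add_zero]

theorem innerHom_sub_mem (d : crossedHom ρ σ) (φ : U →ₗ[k] V)
    (h : ∀ m, (d - innerHom ρ σ φ).1 m = 0) : d ∈ LinearMap.range (innerHom ρ σ) :=
  ⟨φ, (sub_eq_zero.1 (Subtype.ext (funext h))).symm⟩

/-- Crossed homomorphisms between representations supported on incomparable ideals are inner. -/
theorem crossedHom_inner_of_incomparable (hM : IsOrthogroup M) {e f : M}
    (he : ρ e = 1) (hf : σ f = 1) (he' : σ e = 0) (hf' : ρ f = 0) (d : crossedHom ρ σ) :
    d ∈ LinearMap.range (innerHom ρ σ) := by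
  -- As `σ e = 0` and `ρ e = 1`, the inner crossed homomorphism of `φ` has value `-φ` at `e`; this
  -- choice cancels `d(e)`.
  refine innerHom_sub_mem d (-d.1 e) fun m => ?_
  set d' := d - innerHom ρ σ (-d.1 e) with hd'
  have h0 : d'.1 e = 0 := by
    ext u
    change d.1 e u - (innerHom ρ σ (-d.1 e)).1 e u = 0
    rw [innerHom_apply, he', he]
    simp
  have h1 : ∀ n, d'.1 (n * e) = d'.1 n := fun n => by
    rw [d'.2, h0, he, LinearMap.comp_zero, zero_add]; rfl
  -- The element `fne` kills both modules: `f` kills the source and `e` the target. Taking `n = e`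
  -- afterwards gives `d'(f) = 0`.
  have h2 : ∀ n, d'.1 n + d'.1 f ∘ₗ ρ n = 0 := fun n => by
    have h3 : d'.1 (f * (n * e)) = 0 :=
      crossedHom_eq_zero hM d' (by rw [map_mul, hf', zero_mul])
        (by rw [map_mul, map_mul, he', mul_zero, mul_zero])
    rw [← mul_assoc, h1, d'.2, hf] at h3
    exact h3
  have h4 : d'.1 f = 0 := by
    have := h2 e
    rw [h0, he, zero_add] at this
    exact this
  have := h2 m
  rwa [h4, LinearMap.zero_comp, add_zero] at this

/-- Crossed homomorphisms between representations supported on the same ideal are inner. -/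
theorem crossedHom_inner_of_eq [Finite M] (hM : IsOrthogroup M) {e : M} (hidem : IsIdempotentElem e)
    (he : ρ e = 1) (he' : σ e = 1) (hρ : ∀ m, e ∉ twoSided m → ρ m = 0)
    (hσ : ∀ m, e ∉ twoSided m → σ m = 0) (hcard : (Nat.card (MaxSubgroup hidem) : k) ≠ 0)
    (d : crossedHom ρ σ) : d ∈ LinearMap.range (innerHom ρ σ) := by
  have := Fintype.ofFinite (MaxSubgroup hidem)
  -- The group average that trivialises a cocycle when the group order is invertible; `key` says
  -- that `d` agrees on the subgroup with the inner crossed homomorphism of `-φ`.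
  let φ : U →ₗ[k] V := (Nat.card (MaxSubgroup hidem) : k)⁻¹ •
    ∑ g : MaxSubgroup hidem, d.1 g.val ∘ₗ ρ (g⁻¹).val
  have key : ∀ h : MaxSubgroup hidem, σ h.val ∘ₗ φ = φ ∘ₗ ρ h.val - d.1 h.val := by
    intro h
    have h1 : ∀ g : MaxSubgroup hidem, σ h.val ∘ₗ (d.1 g.val ∘ₗ ρ (g⁻¹).val) =
        (d.1 (h * g).val ∘ₗ ρ ((h * g)⁻¹).val) ∘ₗ ρ h.val - d.1 h.val := by
      intro g
      have h2 : ρ g.val * ρ (g⁻¹).val = 1 := by rw [← map_mul, g.mul_inv_val, he]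
      have h3 : ρ ((h * g)⁻¹).val * ρ h.val = ρ (g⁻¹).val := by
        rw [← map_mul, ← MaxSubgroup.val_mul, mul_inv_rev, inv_mul_cancel_right]
      rw [LinearMap.comp_assoc, ← Module.End.mul_eq_comp (ρ _), h3, MaxSubgroup.val_mul, d.2,
        LinearMap.add_comp, LinearMap.comp_assoc, LinearMap.comp_assoc,
        ← Module.End.mul_eq_comp (ρ _), h2, Module.End.one_eq_id, LinearMap.comp_id,
        add_sub_cancel_right]
    have h4 : σ h.val ∘ₗ ∑ g : MaxSubgroup hidem, d.1 g.val ∘ₗ ρ (g⁻¹).val =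
        ∑ g : MaxSubgroup hidem, σ h.val ∘ₗ (d.1 g.val ∘ₗ ρ (g⁻¹).val) := by ext; simp
    have h5 : (∑ g : MaxSubgroup hidem, d.1 g.val ∘ₗ ρ (g⁻¹).val) ∘ₗ ρ h.val =
        ∑ g : MaxSubgroup hidem, (d.1 g.val ∘ₗ ρ (g⁻¹).val) ∘ₗ ρ h.val := by ext; simp
    rw [LinearMap.comp_smul, LinearMap.smul_comp, h4, h5,
      Finset.sum_congr rfl fun g _ => h1 g, Finset.sum_sub_distrib,
      Finset.sum_const, Finset.card_univ, ← Nat.card_eq_fintype_card, smul_sub,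
      ← Nat.cast_smul_eq_nsmul k, smul_smul, inv_mul_cancel₀ hcard, one_smul,
      (Group.mulLeft_bijective h).sum_comp
        (fun g => (d.1 g.val ∘ₗ ρ (g⁻¹).val) ∘ₗ ρ h.val)]
  refine innerHom_sub_mem d (-φ) fun m => ?_
  set d' := d - innerHom ρ σ (-φ) with hd'
  by_cases hm : e ∈ twoSided m
  · have hG : ∀ g : MaxSubgroup hidem, d'.1 g.val = 0 := fun g => by
      ext u
      change d.1 g.val u - (innerHom ρ σ (-φ)).1 g.val u = 0
      have := LinearMap.congr_fun (key g) u
      rw [LinearMap.comp_apply, LinearMap.sub_apply, LinearMap.comp_apply] at this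
      rw [innerHom_apply, LinearMap.neg_apply, map_neg, this, LinearMap.neg_apply]
      abel
    have h0 : d'.1 e = 0 := hG 1
    obtain ⟨g, hg⟩ := exists_maxSubgroup hM.rectangular hidem hm
    have h1 := hG g
    rw [hg, d'.2, h0, he, LinearMap.comp_zero, zero_add, d'.2, h0, he', LinearMap.zero_comp,
      add_zero] at h1
    exact h1
  · exact crossedHom_eq_zero hM d' (hρ m hm) (hσ m hm)

end Vanishing

/-! ### The set `e_Y L_{e_X}` and the cocycles on it. -/

namespace IdemPair

section Carrier

variable {M : Type v} [Monoid M] [Finite M] (P : IdemPair M)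

theorem carrier_ext {x y : P.carrier} (h : (x : M) = y) : x = y := Subtype.ext h

theorem eX_mem_carrier (hM : IsOrthogroup M) (x : P.carrier) : P.eX ∈ twoSided (x : M) := by
  obtain ⟨w, hw⟩ := P.exists_mul_eq hM.rectangular x
  exact ⟨w * P.eX, 1, by rw [mul_one, mul_assoc, hw]⟩

/-- All of `e_Y L_{e_X}` lies in the `𝒥`-class of `e_X`, so `e_X` can be inserted to the left of its
elements after factors from that class. -/
theorem twoSided_carrier (hM : IsOrthogroup M) (x : P.carrier) :
    twoSided (x : M) = twoSided P.eX :=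
  twoSided_eq ⟨x, 1, by rw [mul_one, P.mul_eX]⟩ (P.eX_mem_carrier hM x)

theorem exists_mul_eX (hM : IsOrthogroup M) {m : M} (hm : P.eX ∈ twoSided m) :
    ∃ u : M, u * (P.eX * m * P.eX) = P.eX := by
  obtain ⟨g, hg⟩ := exists_maxSubgroup hM.rectangular P.idemX hm
  exact ⟨(g⁻¹).val, by rw [← hg, g.inv_mul_val]⟩

theorem mem_lClass (hM : IsOrthogroup M) {m : M} (hm : P.eX ∈ twoSided m) :
    m * P.eX ∈ P.lClass := by
  obtain ⟨u, hu⟩ := P.exists_mul_eX hM hm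
  refine Set.Subset.antisymm ?_ ?_
  · rintro _ ⟨a, rfl⟩
    exact ⟨a * m, by simp only [mul_assoc]⟩
  · rintro _ ⟨a, rfl⟩
    exact ⟨a * (u * P.eX), by rw [mul_assoc, mul_assoc u, ← mul_assoc P.eX, hu]⟩

/-- The element `e_Y m e_X` of `e_Y L_{e_X}`, for `m` with `e_X ∈ MmM`. -/
def proj (hM : IsOrthogroup M) (m : M) (hm : P.eX ∈ twoSided m) : P.carrier :=
  ⟨P.eY * m * P.eX, m * P.eX, P.mem_lClass hM hm, by rw [mul_assoc]⟩

theorem coe_proj (hM : IsOrthogroup M) (m : M) (hm : P.eX ∈ twoSided m) :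
    (P.proj hM m hm : M) = P.eY * m * P.eX := rfl

theorem coe_act (hM : IsRectangular M) (g : MaxSubgroup P.idemY) (h : MaxSubgroup P.idemX)
    (x : P.carrier) : (P.act hM g h x : M) = g.val * x * (h⁻¹).val := rfl

theorem coe_retr (hM : IsRectangular M) (x : P.carrier) : (P.retr hM x : M) = P.eX * x := rfl

theorem retr_eq_self (hM : IsRectangular M) {x : P.carrier} (h : P.eX * (x : M) = x) :
    P.retr hM x = x := Subtype.ext h

end Carrier

section Cocycles

variable {k : Type u} {M : Type v} [Field k] [Monoid M] [Finite M] (P : IdemPair M)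
variable {U V : Type w} [AddCommGroup U] [Module k U] [AddCommGroup V] [Module k V]
variable (hM : IsOrthogroup M) (ρ : Representation k M U) (σ : Representation k M V)

/-- The functions on `e_Y L_{e_X}` that are the restrictions of the crossed homomorphisms vanishing
at `e_X`. -/
def cocycles : Submodule k (P.carrier → U →ₗ[k] V) where
  carrier := {F | (∀ x x', P.Rel x x' → F x = F x') ∧
    (∀ x, F (P.retr hM.rectangular x) = 0) ∧
    ∀ g h x, F (P.act hM.rectangular g h x) -
      F (P.act hM.rectangular g h (P.retr hM.rectangular x)) =
        σ g.val ∘ₗ F x ∘ₗ ρ (h⁻¹).val}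
  zero_mem' := by
    refine ⟨fun _ _ _ => rfl, fun _ => rfl, fun g h x => ?_⟩
    simp
  add_mem' := by
    rintro F F' ⟨h1, h2, h3⟩ ⟨h1', h2', h3'⟩
    refine ⟨fun x x' h => ?_, fun x => ?_, fun g h x => ?_⟩
    · rw [Pi.add_apply, Pi.add_apply, h1 x x' h, h1' x x' h]
    · rw [Pi.add_apply, h2, h2', add_zero]
    · rw [Pi.add_apply, Pi.add_apply, Pi.add_apply, LinearMap.add_comp, LinearMap.comp_add,
        ← h3, ← h3', add_sub_add_comm]
  smul_mem' := by
    rintro c F ⟨h1, h2, h3⟩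
    refine ⟨fun x x' h => ?_, fun x => ?_, fun g h x => ?_⟩
    · rw [Pi.smul_apply, Pi.smul_apply, h1 x x' h]
    · rw [Pi.smul_apply, h2, smul_zero]
    · rw [Pi.smul_apply, Pi.smul_apply, Pi.smul_apply, LinearMap.smul_comp, LinearMap.comp_smul,
        ← h3, smul_sub]

open scoped Classical in
/-- The extension `m ↦ F(e_Y m e_X)` to all of `M`, by `0` where `e_Y m e_X` is not in
`e_Y L_{e_X}`. -/
noncomputable def extend (F : P.carrier → U →ₗ[k] V) (m : M) : U →ₗ[k] V :=
  if hm : P.eX ∈ twoSided m then F (P.proj hM m hm) else 0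

theorem extend_eq (F : P.carrier → U →ₗ[k] V) {m : M} {x : P.carrier}
    (h : P.eY * m * P.eX = x) : P.extend hM F m = F x := by
  have hm : P.eX ∈ twoSided m :=
    (of_mul_mem (of_mul_mem (h ▸ P.eX_mem_carrier hM x : P.eX ∈ twoSided (P.eY * m * P.eX))).1).2
  rw [extend, dif_pos hm]
  exact congrArg F (Subtype.ext h)

theorem extend_of_notMem (F : P.carrier → U →ₗ[k] V) {m : M} (h : P.eX ∉ twoSided m) :
    P.extend hM F m = 0 := dif_neg h

theorem extend_coe (F : P.carrier → U →ₗ[k] V) (x : P.carrier) : P.extend hM F x = F x :=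
  P.extend_eq hM F (by rw [P.eY_mul, P.mul_eX])

variable {ρ σ}

theorem cocycles_of_eX_mul {F : P.carrier → U →ₗ[k] V} (hF : F ∈ P.cocycles hM ρ σ)
    {x : P.carrier} (h : P.eX * (x : M) = x) : F x = 0 := by
  rw [← P.retr_eq_self hM.rectangular h]
  exact hF.2.1 x

/-- If `m` or `n` lies outside `M_X`, all terms vanish. Otherwise put `p = e_Y m e_Y` and `y = e_Y n
e_X`. Relation (a) turns the left side into `F(py)`, and equivariance under `G_X` turns `F(e_Y m
e_X) ρ(n)` into `F(p e_X y)`. What remains is `F(py) = σ(m) F(y) + F(p e_X y)`: equivariance under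
`G_Y` when `p ∈ G_Y`, and relation (b) or plain equality when `σ(m) = 0`. -/
theorem cocycles_mul (hρ : ρ P.eX = 1) (hρ' : ∀ m, P.eX ∉ twoSided m → ρ m = 0)
    (hσ : σ P.eY = 1) (hσ' : ∀ m, P.eY ∉ twoSided m → σ m = 0)
    {F : P.carrier → U →ₗ[k] V} (hF : F ∈ P.cocycles hM ρ σ) (m n : M) :
    P.extend hM F (m * n) = σ m ∘ₗ P.extend hM F n + P.extend hM F m ∘ₗ ρ n := by
  have hXY : P.eX ∈ twoSided P.eY := ⟨1, P.eX, by rw [one_mul, P.left_mul]⟩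
  have hXX : P.eX ∈ twoSided P.eX := mem_twoSided_self _
  by_cases hm : P.eX ∈ twoSided m
  swap
  · have h1 : P.eX ∉ twoSided (m * n) := fun h => hm (of_mul_mem h).1
    rw [extend_of_notMem _ _ _ h1, extend_of_notMem _ _ _ hm,
      hσ' m fun h => hm (mem_twoSided_trans hXY h), LinearMap.zero_comp, LinearMap.zero_comp,
      add_zero]
  by_cases hn : P.eX ∈ twoSided n
  swap
  · have h1 : P.eX ∉ twoSided (m * n) := fun h => hn (of_mul_mem h).2
    rw [extend_of_notMem _ _ _ h1, extend_of_notMem _ _ _ hn, hρ' n hn, LinearMap.comp_zero,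
      LinearMap.comp_zero, add_zero]
  obtain ⟨h, hh⟩ := exists_maxSubgroup hM.rectangular P.idemX hn
  have hfmf : P.eX ∈ twoSided (P.eY * m * P.eY) := hM.mul_mem (hM.mul_mem hXY hm) hXY
  set p := P.eY * m * P.eY with hp
  set y := P.proj hM n hn with hy
  set z := P.proj hM m hm with hz
  have hyc : (y : M) = P.eY * n * P.eX := rfl
  have hzc : (z : M) = P.eY * m * P.eX := rfl
  have hpe : p * P.eX = z := by rw [hzc, hp, mul_assoc, P.left_mul]
  have hey : P.eX * (y : M) = h.val := by
    rw [hyc, hh, ← mul_assoc, ← mul_assoc, P.right_mul]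
  have hEm : P.extend hM F m = F z := P.extend_eq hM F rfl
  have hEn : P.extend hM F n = F y := P.extend_eq hM F rfl
  have hpy : P.eX ∈ twoSided (p * (y : M)) := hM.mul_mem hfmf (P.eX_mem_carrier hM y)
  have hfp : P.eY * p = p := by rw [hp, ← mul_assoc, ← mul_assoc, P.idemY.eq]
  have hpf : p * P.eY = p := by rw [hp, mul_assoc, P.idemY.eq]
  let xy : P.carrier := ⟨p * y, by
    have := (P.proj hM _ hpy).2
    rwa [coe_proj, ← mul_assoc, hfp, mul_assoc, P.mul_eX] at this⟩
  have hxy : (xy : M) = p * y := rfl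
  have hmn : P.extend hM F (m * n) = F xy := by
    have h1 : P.extend hM F (m * n) = F (P.proj hM (m * n) (hM.mul_mem hm hn)) :=
      P.extend_eq hM F rfl
    rw [h1]
    refine hF.1 _ _ (Rel.a _ _ m (n * P.eX) ?_ (P.mem_lClass hM hn) ?_ ?_)
    · rw [hM.support_eq]; exact twoSided_subset_iff.2 hm
    · rw [coe_proj]; simp only [mul_assoc]
    · rw [hxy, hyc, hp]; simp only [mul_assoc]; rw [← mul_assoc P.eY P.eY, P.idemY.eq]
  -- The operator `ρ n` is that of `h = e_X n e_X`. The correction term of the equivariance rule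
  -- vanishes because its argument is fixed by `e_X` on the left; `h⁻¹` appears because the action
  -- multiplies on the right by the inverse.
  have hzn : F (P.act hM.rectangular 1 h⁻¹ z) = F z ∘ₗ ρ n := by
    have h1 := hF.2.2 1 h⁻¹ z
    have h2 : F (P.act hM.rectangular 1 h⁻¹ (P.retr hM.rectangular z)) = 0 := by
      apply P.cocycles_of_eX_mul hM hF
      rw [coe_act, coe_retr, MaxSubgroup.val_one, ← mul_assoc P.eY, P.left_mul, ← mul_assoc,
        ← mul_assoc, P.idemX.eq]
    have h3 : ρ h.val = ρ n := by rw [hh, map_mul, map_mul, hρ, one_mul, mul_one]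
    rw [h2, sub_zero, MaxSubgroup.val_one, hσ, inv_inv, h3] at h1
    exact h1
  have hactz : (P.act hM.rectangular 1 h⁻¹ z : M) = p * P.eX * y := by
    rw [coe_act, MaxSubgroup.val_one, inv_inv, P.eY_mul, ← hey, ← mul_assoc, P.mul_eX, hpe]
  rw [hmn, hEm, hEn, ← hzn]
  by_cases hY : P.eY ∈ twoSided m
  · obtain ⟨g, hg⟩ := exists_maxSubgroup hM.rectangular P.idemY hY
    have h1 := hF.2.2 g 1 y
    have h2 : P.act hM.rectangular g 1 y = xy := P.carrier_ext <| by
      rw [coe_act, inv_one, MaxSubgroup.val_one, mul_assoc, P.mul_eX, hxy, hg]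
    have h3 : P.act hM.rectangular g 1 (P.retr hM.rectangular y) =
        P.act hM.rectangular 1 h⁻¹ z := P.carrier_ext <| by
      rw [hactz, coe_act, coe_retr, inv_one, MaxSubgroup.val_one, hg, ← hp, mul_assoc p,
        mul_assoc P.eX, P.mul_eX, mul_assoc p]
    have h4 : σ g.val = σ m := by rw [hg, map_mul, map_mul, hσ, one_mul, mul_one]
    rw [h2, h3, inv_one, MaxSubgroup.val_one, hρ, h4, sub_eq_iff_eq_add] at h1
    exact h1
  · rw [hσ' m hY, LinearMap.zero_comp, zero_add]
    by_cases hpX : twoSided p = twoSided P.eX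
    · refine congrArg F (P.carrier_ext ?_)
      rw [hactz, hxy, hM.mul_idem_mul P.idemX hpX (P.twoSided_carrier hM y)]
    -- The idempotent power of `p` is the witness for relation (b): it fixes `p` on the left,
    -- generates an ideal strictly above `X`, and differs from `e_Y` because `m ∉ M_Y`.
    · obtain ⟨j, hj, hjJ, hjp⟩ := hM.exists_idempotent_pow p
      refine hF.1 _ _ (Rel.b _ _ ?_ (p ^ (j + 1)) hj ⟨p ^ (j + 1), ?_⟩ ?_ ?_ ?_ ?_)
      · have hJ : twoSided (P.eX * p) = twoSided P.eX :=
          twoSided_eq ⟨1, p, by rw [one_mul]⟩ (hM.mul_mem hXX hfmf)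
        rw [hactz, hxy, ← mul_assoc P.eX p, ← mul_assoc P.eX (p * P.eX), ← mul_assoc P.eX p P.eX,
          hM.mul_idem_mul P.idemX hJ (P.twoSided_carrier hM y)]
      · have h1 : P.eY * p ^ (j + 1) = p ^ (j + 1) := by rw [pow_succ', ← mul_assoc, hfp]
        have h2 : p ^ (j + 1) * P.eY = p ^ (j + 1) := by rw [pow_succ, mul_assoc, hpf]
        rw [h1, h2]
      · rw [hM.support_eq, hjJ]
        exact (twoSided_subset_iff.2 hfmf).ssubset_of_ne (Ne.symm hpX)
      · intro h1
        rw [h1] at hjJ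
        have h2 : P.eY ∈ twoSided p := hjJ ▸ mem_twoSided_self P.eY
        exact hY (of_mul_mem (of_mul_mem h2).1).2
      · rw [hxy, ← mul_assoc, hjp]
      · rw [hactz, ← mul_assoc, ← mul_assoc, hjp]

/-- Relation (a) is respected because `d(e_Y) = 0` and `e_Y` acts as `1` on both modules. For (b),
`σ(e) = 0` gives `d(x) = d(e) ρ(x) = d(e) ρ(e_X x)`. In the equivariance rule the term `d(g) ρ(x)`
occurs in both `d(gx)` and `d(g e_X x)` and cancels. -/
theorem crossedHom_mem_cocycles (hρ : ρ P.eX = 1)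
    (hσ : σ P.eY = 1) (hσ' : ∀ m, P.eY ∉ twoSided m → σ m = 0) (hlt : P.eY ∉ twoSided P.eX)
    (d : crossedHom ρ σ) (hd : d.1 P.eX = 0) :
    (fun x : P.carrier => d.1 x) ∈ P.cocycles hM ρ σ := by
  have hσX : σ P.eX = 0 := hσ' _ hlt
  have hρY : ρ P.eY = 1 := by rw [← mul_one (ρ P.eY), ← hρ, ← map_mul, P.left_mul]
  -- Idempotency gives `d(e_Y) = d(e_Y) + d(e_Y)`.
  have hdY : d.1 P.eY = 0 := by
    have h := d.2 P.eY P.eY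
    rw [P.idemY.eq, hρY, hσ] at h
    exact left_eq_add.1 h
  have hY : ∀ n, d.1 (P.eY * n) = d.1 n := fun n => by
    rw [d.2, hdY, hσ, LinearMap.zero_comp, add_zero]; rfl
  have hX : ∀ n, d.1 (P.eX * n) = 0 := fun n => by
    rw [d.2, hd, hσX, LinearMap.zero_comp, LinearMap.zero_comp, add_zero]
  have hρX : ∀ n, ρ (P.eX * n) = ρ n := fun n => by rw [map_mul, hρ, one_mul]
  refine ⟨fun x x' h => ?_, fun x => hX x, fun g h x => ?_⟩
  · cases h with
    | a m l hm hl hx hx' =>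
      change d.1 x = d.1 x'
      rw [hx, hx', mul_assoc, mul_assoc, mul_assoc, hY, hY, d.2, d.2 m, hY, map_mul, hρY, one_mul]
    | b h e he hmem hX hne hx hx' =>
      -- An idempotent of `e_Y M e_Y` generating `Y` would equal `e_Y` by rectangularity, so `e`
      -- lies outside `M_Y`.
      have he0 : σ e = 0 := by
        apply hσ'
        intro h1
        obtain ⟨m, hm⟩ := hmem
        refine hne (hM.idempotent_eq he P.idemY (twoSided_eq ?_ h1) ?_ ?_)
        · exact ⟨P.eY * m, 1, by rw [mul_one, hm]⟩
        · rw [hm, ← mul_assoc, ← mul_assoc, P.idemY.eq]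
        · rw [hm, mul_assoc, P.idemY.eq]
      change d.1 x = d.1 x'
      rw [← hx, ← hx', d.2, d.2 e, he0, LinearMap.zero_comp, LinearMap.zero_comp, ← hρX x, h, hρX]
  · have hh : d.1 (h⁻¹).val = 0 := by rw [← (h⁻¹).left_mul]; exact hX _
    change d.1 (g.val * x * (h⁻¹).val) - d.1 (g.val * (P.eX * x) * (h⁻¹).val) = _
    rw [d.2, d.2 _ (h⁻¹).val, hh, LinearMap.comp_zero, LinearMap.comp_zero, zero_add, zero_add,
      d.2, d.2 g.val, hX, hρX, LinearMap.comp_zero, zero_add, LinearMap.add_comp,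
      add_sub_cancel_right, LinearMap.comp_assoc]

end Cocycles

/-- The number of arrows is the dimension of the space of cocycles on `e_Y L_{e_X}`. -/
theorem numArrows_eq_rank_cocycles {k : Type u} {M : Type v} [Field k] [Monoid M] [Finite M]
    (P : IdemPair M) {U V : Type (max u v)} [AddCommGroup U] [Module k U] [AddCommGroup V]
    [Module k V] (hM : IsOrthogroup M) (ρ : Representation k M U) (σ : Representation k M V)
    (hρ : ρ P.eX = 1) (hρ' : ∀ m, P.eX ∉ twoSided m → ρ m = 0) (hσ : σ P.eY = 1)
    (hσ' : ∀ m, P.eY ∉ twoSided m → σ m = 0) (hlt : P.eY ∉ twoSided P.eX) :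
    numArrows ρ σ = Module.rank k (P.cocycles hM ρ σ) := by
  have hσX : σ P.eX = 0 := hσ' _ hlt
  let j : P.cocycles hM ρ σ →ₗ[k] crossedHom ρ σ :=
    { toFun := fun F => ⟨P.extend hM F.1, P.cocycles_mul hM hρ hρ' hσ hσ' F.2⟩
      map_add' := fun F F' => by
        apply Subtype.ext
        funext m
        change P.extend hM (F.1 + F'.1) m = P.extend hM F.1 m + P.extend hM F'.1 m
        unfold extend
        split_ifs
        · rfl
        · rw [add_zero]
      map_smul' := fun c F => by
        apply Subtype.ext
        funext m
        change P.extend hM (c • F.1) m = c • P.extend hM F.1 m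
        unfold extend
        split_ifs
        · rfl
        · rw [smul_zero] }
  have hjX : ∀ F, (j F).1 P.eX = 0 := fun F => by
    change P.extend hM F.1 P.eX = 0
    rw [P.extend_eq hM F.1 (x := P.proj hM P.eX (mem_twoSided_self _)) rfl]
    apply P.cocycles_of_eX_mul hM F.2
    rw [coe_proj, P.left_mul, P.idemX.eq, P.idemX.eq]
  -- Hence the crossed homomorphisms vanishing at `e_X` form a complement of the inner ones.
  have hinner : ∀ φ : U →ₗ[k] V, (innerHom ρ σ φ).1 P.eX = -φ := fun φ => by
    ext u
    rw [innerHom_apply, hσX, hρ]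
    simp
  refine numArrows_eq_rank ρ σ j (fun F hF => ?_) fun d => ?_
  · obtain ⟨φ, hφ⟩ := hF
    have h0 : φ = 0 := by
      have h1 := hjX F
      rw [← hφ, hinner] at h1
      exact neg_eq_zero.1 h1
    rw [h0, map_zero] at hφ
    apply Subtype.ext
    funext x
    have h1 : (j F).1 x = 0 := by rw [← hφ]; rfl
    rw [← P.extend_coe hM F.1 x]
    exact h1
  · set d' := d - innerHom ρ σ (-d.1 P.eX) with hd'
    have h0 : d'.1 P.eX = 0 := by
      change d.1 P.eX - (innerHom ρ σ (-d.1 P.eX)).1 P.eX = 0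
      rw [hinner, neg_neg, sub_self]
    refine ⟨⟨_, P.crossedHom_mem_cocycles hM hρ hσ hσ' hlt d' h0⟩, -d.1 P.eX, ?_⟩
    rw [← sub_eq_iff_eq_add]
    apply Subtype.ext
    funext m
    change d'.1 m = P.extend hM (fun x : P.carrier => d'.1 x) m
    by_cases hm : P.eX ∈ twoSided m
    · rw [P.extend_eq hM _ (x := P.proj hM m hm) rfl, coe_proj, d'.2, h0, LinearMap.comp_zero,
        zero_add, hρ, d'.2, hσ]
      have hρY : ρ P.eY = 1 := by rw [← mul_one (ρ P.eY), ← hρ, ← map_mul, P.left_mul]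
      have hdY : d'.1 P.eY = 0 := by
        have h := d'.2 P.eY P.eY
        rw [P.idemY.eq, hρY, hσ] at h
        exact left_eq_add.1 h
      rw [hdY, LinearMap.zero_comp, add_zero]; rfl
    · rw [extend_of_notMem _ _ _ hm]
      exact crossedHom_eq_zero hM d' (hρ' m hm) (hσ' m fun h =>
        hm (mem_twoSided_trans ⟨1, P.eX, by rw [one_mul, P.left_mul]⟩ h))

end IdemPair

/-! ### The identification of `V ⊗ U*` with `Hom(U, V)`. -/

section HomTensor

variable {k G H U V : Type*} [Field k] [Group G] [Group H] [AddCommGroup U] [Module k U]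
  [AddCommGroup V] [Module k V]

theorem nontrivial_tensorDual [Nontrivial U] [Nontrivial V] :
    Nontrivial (V ⊗[k] Module.Dual k U) := by
  obtain ⟨w, hw⟩ := exists_ne (0 : U)
  obtain ⟨l, hl⟩ := Module.Projective.exists_dual_eq_one k hw
  have : Nontrivial (Module.Dual k U) := ⟨⟨l, 0, fun h => by simp [h] at hl⟩⟩
  infer_instance

variable (k U V) in
/-- The isomorphism `V ⊗ U* ≃ Hom(U, V)`. -/
noncomputable def tensorDualEquivHom [FiniteDimensional k U] :
    V ⊗[k] Module.Dual k U ≃ₗ[k] U →ₗ[k] V :=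
  (TensorProduct.comm k V (Module.Dual k U)).trans (dualTensorHomEquiv k U V)

theorem tensorDualEquivHom_tmul [FiniteDimensional k U] (v : V) (φ : Module.Dual k U) (u : U) :
    tensorDualEquivHom k U V (v ⊗ₜ φ) u = φ u • v := by
  simp [tensorDualEquivHom]

theorem tensorDualEquivHom_apply [FiniteDimensional k U] (σ : Representation k H V)
    (ρ : Representation k G U) (g : H) (h : G) (w : V ⊗[k] Module.Dual k U) :
    tensorDualEquivHom k U V (tensorDual σ ρ (g, h) w) =
      σ g ∘ₗ tensorDualEquivHom k U V w ∘ₗ ρ h⁻¹ := by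
  induction w using TensorProduct.induction_on with
  | zero => simp
  | add x y hx hy => rw [map_add, map_add, map_add, hx, hy, LinearMap.add_comp, LinearMap.comp_add]
  | tmul v φ =>
    ext u
    have : tensorDual σ ρ (g, h) (v ⊗ₜ φ) = σ g v ⊗ₜ ρ.dual h φ := rfl
    rw [this, tensorDualEquivHom_tmul, LinearMap.comp_apply, LinearMap.comp_apply,
      tensorDualEquivHom_tmul, map_smul, Representation.dual_apply]
    rfl

end HomTensor

/-! ### Classes modulo `≡` and the module `V_{X,Y}`. -/

namespace IdemPair

variable {k : Type u} {M : Type v} [Field k] [Monoid M] [Finite M] (P : IdemPair M)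
  (hM : IsOrthogroup M)

section Classes

/-- The class of an element of `e_Y L_{e_X}`. -/
def mkClass (x : P.carrier) : P.Classes := Quotient.mk P.equivRel x

/-- For (b) this is part of the relation. For (a), `e_X m` and `l` lie in the `𝒥`-class of `e_X`, so
`e_X` can be inserted between them, absorb `e_Y`, and be removed again. Hence the retraction `x ↦
e_X x` is constant on classes. -/
theorem eX_mul_eq_of_rel (hM : IsOrthogroup M) {x x' : P.carrier} (h : P.Rel x x') :
    P.eX * (x : M) = P.eX * (x' : M) := by
  cases h with
  | b h => exact h
  | a m l hm hl hx hx' =>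
    rw [hM.support_eq] at hm
    have hm' : P.eX ∈ twoSided m := twoSided_subset_iff.1 hm
    have hXY : P.eX ∈ twoSided P.eY := ⟨1, P.eX, by rw [one_mul, P.left_mul]⟩
    have hl1 : twoSided l = twoSided P.eX := by
      have h1 : l ∈ leftIdeal P.eX := hl ▸ ⟨1, (one_mul l).symm⟩
      have h2 : P.eX ∈ leftIdeal l := hl ▸ ⟨1, (one_mul _).symm⟩
      obtain ⟨a, ha⟩ := h1
      obtain ⟨b, hb⟩ := h2
      exact twoSided_eq ⟨a, 1, by rw [mul_one, ha]⟩ ⟨b, 1, by rw [mul_one, ← hb]⟩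
    have hem : twoSided (P.eX * m) = twoSided P.eX :=
      twoSided_eq ⟨1, m, by rw [one_mul]⟩ (hM.mul_mem (mem_twoSided_self _) hm')
    have hfl : twoSided (P.eY * l) = twoSided P.eX :=
      twoSided_eq (mem_twoSided_trans ⟨P.eY, 1, by rw [mul_one]⟩ (hl1 ▸ mem_twoSided_self l))
        (hM.mul_mem hXY (hl1 ▸ mem_twoSided_self P.eX))
    calc P.eX * (x : M) = P.eX * m * l := by
          rw [hx, ← mul_assoc, ← mul_assoc, P.right_mul]
      _ = P.eX * m * P.eX * l := (hM.mul_idem_mul P.idemX hem hl1).symm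
      _ = P.eX * m * P.eX * (P.eY * l) := by
          rw [mul_assoc _ P.eX (P.eY * l), ← mul_assoc P.eX P.eY, P.right_mul, ← mul_assoc]
      _ = P.eX * m * (P.eY * l) := hM.mul_idem_mul P.idemX hem hfl
      _ = P.eX * (x' : M) := by
          rw [hx']; simp only [mul_assoc]; rw [← mul_assoc P.eX P.eY, P.right_mul]

theorem retr_eq_of_equiv {x x' : P.carrier} (h : P.equivRel x x') :
    P.retr hM.rectangular x = P.retr hM.rectangular x' := by
  induction h with
  | rel x x' h => exact Subtype.ext (P.eX_mul_eq_of_rel hM h)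
  | refl x => rfl
  | symm x y _ ih => exact ih.symm
  | trans x y z _ _ ih1 ih2 => exact ih1.trans ih2

/-- Relation (a) is transported by replacing `m` with `gm` and `l` with `l h⁻¹`; relation (b) by
replacing `e` with its conjugate `g e g⁻¹`. -/
theorem act_rel {x x' : P.carrier} (h : P.Rel x x') (g : MaxSubgroup P.idemY)
    (h' : MaxSubgroup P.idemX) :
    P.Rel (P.act hM.rectangular g h' x) (P.act hM.rectangular g h' x') := by
  have hXY : P.eX ∈ twoSided P.eY := ⟨1, P.eX, by rw [one_mul, P.left_mul]⟩
  have hg : P.eX ∈ twoSided g.val := mem_twoSided_trans hXY g.mem_twoSided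
  cases h with
  | a m l hm hl hx hx' =>
    refine Rel.a _ _ (g.val * m) (l * (h'⁻¹).val) ?_ ?_ ?_ ?_
    · rw [hM.support_eq] at hm ⊢
      exact twoSided_subset_iff.2 (hM.mul_mem hg (twoSided_subset_iff.1 hm))
    · have h1 : P.eX ∈ leftIdeal l := hl ▸ ⟨1, (one_mul _).symm⟩
      obtain ⟨b, hb⟩ := h1
      rw [← (h'⁻¹).mul_right, ← mul_assoc]
      exact P.mem_lClass hM (hM.mul_mem ⟨b, 1, by rw [mul_one, ← hb]⟩ (h'⁻¹).mem_twoSided)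
    · rw [coe_act, hx]; simp only [← mul_assoc]; rw [g.left_mul, g.mul_right]
    · rw [coe_act, hx']; simp only [← mul_assoc]; rw [g.left_mul, g.mul_right]
  | b h e he hmem hX hne hx hx' =>
    obtain ⟨n, hn⟩ := hmem
    have hfe : P.eY * e = e := by rw [hn, ← mul_assoc, ← mul_assoc, P.idemY.eq]
    have hef : e * P.eY = e := by rw [hn, mul_assoc, P.idemY.eq]
    have hconj : (g⁻¹).val * (g.val * e * (g⁻¹).val) * g.val = e := by
      rw [← mul_assoc, ← mul_assoc, g.inv_mul_val, mul_assoc, g.inv_mul_val, hfe, hef]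
    have hact : ∀ y : P.carrier, e * (y : M) = y →
        g.val * e * (g⁻¹).val * (P.act hM.rectangular g h' y : M) =
          P.act hM.rectangular g h' y := by
      intro y hy
      rw [coe_act]
      calc g.val * e * (g⁻¹).val * (g.val * y * (h'⁻¹).val) =
            g.val * (e * ((g⁻¹).val * g.val) * y) * (h'⁻¹).val := by simp only [mul_assoc]
        _ = g.val * y * (h'⁻¹).val := by rw [g.inv_mul_val, hef, hy]
    refine Rel.b _ _ ?_ (g.val * e * (g⁻¹).val) ?_ ⟨g.val * e * (g⁻¹).val, ?_⟩ ?_ ?_ (hact _ hx)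
      (hact _ hx')
    · have heg : twoSided (P.eX * g.val) = twoSided P.eX :=
        twoSided_eq ⟨1, g.val, by rw [one_mul]⟩ (hM.mul_mem (mem_twoSided_self _) hg)
      have key : ∀ y : P.carrier, P.eX * (P.act hM.rectangular g h' y : M) =
          P.eX * g.val * (P.eX * (y : M)) * (h'⁻¹).val := fun y => by
        rw [← mul_assoc (P.eX * g.val), hM.mul_idem_mul P.idemX heg (P.twoSided_carrier hM y),
          coe_act, ← mul_assoc, ← mul_assoc]
      rw [key, key, h]
    · change g.val * e * (g⁻¹).val * (g.val * e * (g⁻¹).val) = g.val * e * (g⁻¹).val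
      calc g.val * e * (g⁻¹).val * (g.val * e * (g⁻¹).val) =
            g.val * (e * ((g⁻¹).val * g.val) * e) * (g⁻¹).val := by simp only [mul_assoc]
        _ = g.val * e * (g⁻¹).val := by rw [g.inv_mul_val, hef, he.eq]
    · rw [← mul_assoc, ← mul_assoc, g.left_mul, mul_assoc _ (g⁻¹).val, (g⁻¹).mul_right]
    · rw [hM.support_eq] at hX ⊢
      have : twoSided (g.val * e * (g⁻¹).val) = twoSided e :=
        twoSided_eq ⟨g.val, (g⁻¹).val, rfl⟩ ⟨(g⁻¹).val, g.val, hconj.symm⟩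
      rwa [this]
    · intro h1
      rw [h1, (g⁻¹).mul_right, g.inv_mul_val] at hconj
      exact hne hconj.symm

/-- The map induced by `x ↦ g x h⁻¹` on classes. -/
def classAct (gh : MaxSubgroup P.idemY × MaxSubgroup P.idemX) : P.Classes → P.Classes :=
  Quotient.map (P.act hM.rectangular gh.1 gh.2) fun x x' h => by
    induction h with
    | rel x x' h => exact Relation.EqvGen.rel _ _ (P.act_rel hM h _ _)
    | refl x => exact Relation.EqvGen.refl _
    | symm x y _ ih => exact Relation.EqvGen.symm _ _ ih
    | trans x y z _ _ ih1 ih2 => exact Relation.EqvGen.trans _ _ _ ih1 ih2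

variable (k)

theorem cls_def (x : P.carrier) : P.cls k x = Finsupp.single (P.mkClass x) 1 := rfl

theorem cls_eq_iff {x x' : P.carrier} : P.cls k x = P.cls k x' ↔ P.equivRel x x' := by
  rw [cls_def, cls_def, Finsupp.single_left_inj one_ne_zero]
  exact Quotient.eq

/-- For `x ∈ G_X` the difference is zero, so excluding `G_X` from the spanning set loses nothing. -/
theorem diff_mem_space (x : P.carrier) : P.diff k hM.rectangular x ∈ P.space k hM.rectangular := by
  by_cases hx : (x : M) ∈ Set.range (MaxSubgroup.val (he := P.idemX))
  · obtain ⟨g, hg⟩ := hx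
    rw [diff, P.retr_eq_self hM.rectangular (by rw [← hg, g.left_mul]), sub_self]
    exact Submodule.zero_mem _
  · exact Submodule.subset_span ⟨x, hx, rfl⟩

theorem diff_retr (x : P.carrier) :
    P.diff k hM.rectangular (P.retr hM.rectangular x) = 0 := by
  have h : P.retr hM.rectangular (P.retr hM.rectangular x) = P.retr hM.rectangular x :=
    P.retr_eq_self hM.rectangular (by rw [coe_retr, ← mul_assoc, P.idemX.eq])
  rw [diff, h, sub_self]

theorem diff_eq_of_rel {x x' : P.carrier} (h : P.Rel x x') :
    P.diff k hM.rectangular x = P.diff k hM.rectangular x' := by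
  have h' : P.equivRel x x' := Relation.EqvGen.rel _ _ h
  rw [diff, diff, P.retr_eq_of_equiv hM h', (P.cls_eq_iff k).2 h']

/-- Since `e_X g` and `x` lie in the `𝒥`-class of `e_X`, one has `e_X g e_X x = e_X g x`. -/
theorem retr_act_retr (g : MaxSubgroup P.idemY) (h : MaxSubgroup P.idemX) (x : P.carrier) :
    P.retr hM.rectangular (P.act hM.rectangular g h (P.retr hM.rectangular x)) =
      P.retr hM.rectangular (P.act hM.rectangular g h x) := by
  apply P.carrier_ext
  have hXY : P.eX ∈ twoSided P.eY := ⟨1, P.eX, by rw [one_mul, P.left_mul]⟩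
  have hg : P.eX ∈ twoSided g.val := mem_twoSided_trans hXY g.mem_twoSided
  have heg : twoSided (P.eX * g.val) = twoSided P.eX :=
    twoSided_eq ⟨1, g.val, by rw [one_mul]⟩ (hM.mul_mem (mem_twoSided_self _) hg)
  rw [coe_retr, coe_retr, coe_act, coe_act, coe_retr, ← mul_assoc, ← mul_assoc, ← mul_assoc,
    ← mul_assoc, ← mul_assoc, hM.mul_idem_mul P.idemX heg (P.twoSided_carrier hM x)]

/-- The image of a difference under `(g, h)` is itself a combination of differences, since both
terms have the same retraction. This keeps the permutation action inside `V_{X,Y}`. -/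
theorem cls_act_sub (g : MaxSubgroup P.idemY) (h : MaxSubgroup P.idemX) (x : P.carrier) :
    P.cls k (P.act hM.rectangular g h x) -
      P.cls k (P.act hM.rectangular g h (P.retr hM.rectangular x)) =
    P.diff k hM.rectangular (P.act hM.rectangular g h x) -
      P.diff k hM.rectangular (P.act hM.rectangular g h (P.retr hM.rectangular x)) := by
  rw [diff, diff, P.retr_act_retr hM, sub_sub_sub_cancel_right]

/-- The nonzero differences are linearly independent. -/
theorem linearIndepOn_diffSet :
    LinearIndepOn k id {v ∈ P.diffSet k hM.rectangular | v ≠ 0} := by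
  classical
  let r : P.Classes → P.Classes := Quotient.map (P.retr hM.rectangular) fun x x' h => by
    rw [P.retr_eq_of_equiv hM h]
  -- This map kills exactly the basis vectors of classes fixed by the retraction, so a nonzero `[x]
  -- - [e_X x]` goes to `[x]`; independence is then inherited from the basis of classes.
  let p : P.ClassSpace k →ₗ[k] P.ClassSpace k :=
    Finsupp.linearCombination k fun c => if r c = c then 0 else Finsupp.single c 1
  have hp : ∀ x, P.diff k hM.rectangular x ≠ 0 →
      p (P.diff k hM.rectangular x) = P.cls k x := by
    intro x hx
    have h1 : r (P.mkClass (P.retr hM.rectangular x)) = P.mkClass (P.retr hM.rectangular x) := by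
      change P.mkClass (P.retr hM.rectangular (P.retr hM.rectangular x)) = _
      rw [P.retr_eq_self hM.rectangular]
      rw [coe_retr, ← mul_assoc, P.idemX.eq]
    have h2 : ¬ r (P.mkClass x) = P.mkClass x := by
      intro h
      apply hx
      have h3 : P.equivRel (P.retr hM.rectangular x) x := Quotient.exact h
      rw [diff, (P.cls_eq_iff k).2 h3, sub_self]
    rw [diff, map_sub, cls_def, cls_def, Finsupp.linearCombination_single,
      Finsupp.linearCombination_single, if_pos h1, if_neg h2, smul_zero, sub_zero, one_smul]
  choose c hc hc' using fun v : {v ∈ P.diffSet k hM.rectangular | v ≠ 0} => v.2.1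
  have hpv : ∀ v, p v.1 = Finsupp.single (P.mkClass (c v)) 1 := fun v => by
    have h0 := v.2.2
    rw [hc' v] at h0 ⊢
    exact hp _ h0
  have hinj : Function.Injective fun v => P.mkClass (c v) := by
    intro v v' h
    have h1 : P.equivRel (c v) (c v') := Quotient.exact h
    apply Subtype.ext
    rw [hc' v, hc' v', diff, diff, P.retr_eq_of_equiv hM h1, (P.cls_eq_iff k).2 h1]
  refine LinearIndependent.of_comp p ?_
  have h1 : LinearIndependent k fun c : P.Classes => (Finsupp.single c 1 : P.ClassSpace k) :=
    Finsupp.linearIndependent_single_one k P.Classes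
  convert h1.comp _ hinj using 1
  funext v
  exact hpv v

/-- The permutation representation of `G_Y × G_X` on the space of classes. -/
noncomputable def classRep :
    Representation k (MaxSubgroup P.idemY × MaxSubgroup P.idemX) (P.ClassSpace k) where
  toFun gh := Finsupp.lmapDomain k k (P.classAct hM gh)
  map_one' := by
    have : P.classAct hM 1 = id := by
      funext c
      induction c using Quotient.inductionOn with | _ x => ?_
      refine congrArg P.mkClass (P.carrier_ext ?_)
      rw [coe_act, Prod.fst_one, Prod.snd_one, inv_one, MaxSubgroup.val_one, MaxSubgroup.val_one,
        P.eY_mul, P.mul_eX]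
    rw [this, Finsupp.lmapDomain_id]; rfl
  map_mul' a b := by
    have : P.classAct hM (a * b) = P.classAct hM a ∘ P.classAct hM b := by
      funext c
      induction c using Quotient.inductionOn with | _ x => ?_
      refine congrArg P.mkClass (P.carrier_ext ?_)
      rw [coe_act, coe_act, coe_act, Prod.fst_mul, Prod.snd_mul, mul_inv_rev, MaxSubgroup.val_mul,
        MaxSubgroup.val_mul]
      simp only [mul_assoc]
    rw [this, Finsupp.lmapDomain_comp]; rfl

theorem classRep_cls (g : MaxSubgroup P.idemY) (h : MaxSubgroup P.idemX) (x : P.carrier) :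
    P.classRep k hM (g, h) (P.cls k x) = P.cls k (P.act hM.rectangular g h x) :=
  Finsupp.mapDomain_single

theorem classRep_mem_space (gh : MaxSubgroup P.idemY × MaxSubgroup P.idemX) (w : P.ClassSpace k)
    (hw : w ∈ P.space k hM.rectangular) : P.classRep k hM gh w ∈ P.space k hM.rectangular := by
  obtain ⟨g, h⟩ := gh
  induction hw using Submodule.span_induction with
  | mem v hv =>
    obtain ⟨x, -, rfl⟩ := hv
    rw [diff, map_sub, classRep_cls, classRep_cls, P.cls_act_sub k hM]
    exact Submodule.sub_mem _ (P.diff_mem_space k hM _) (P.diff_mem_space k hM _)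
  | zero => rw [map_zero]; exact Submodule.zero_mem _
  | add x y _ _ hx hy => rw [map_add]; exact Submodule.add_mem _ hx hy
  | smul c x _ hx => rw [map_smul]; exact Submodule.smul_mem _ c hx

/-- The representation of `G_Y × G_X` on `V_{X,Y}`. -/
noncomputable def spaceRep :
    Representation k (MaxSubgroup P.idemY × MaxSubgroup P.idemX) (P.space k hM.rectangular) :=
  Subrepresentation.toRepresentation
    (ρ := P.classRep k hM) ⟨P.space k hM.rectangular, fun gh _ hw => P.classRep_mem_space k hM gh _ hw⟩

theorem coe_spaceRep (gh : MaxSubgroup P.idemY × MaxSubgroup P.idemX)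
    (w : P.space k hM.rectangular) :
    (P.spaceRep k hM gh w : P.ClassSpace k) = P.classRep k hM gh w := rfl

theorem spaceRep_isAction : P.IsAction k hM.rectangular (P.spaceRep k hM) := by
  intro g h x hx
  rw [coe_spaceRep]
  change P.classRep k hM (g, h) (P.diff k hM.rectangular x) = _
  rw [diff, map_sub, classRep_cls, classRep_cls]

end Classes

end IdemPair

/-! ### Intertwining maps, cocycles and the arrow formula. -/

namespace IdemPair

section ArrowFormula

variable {k : Type u} {M : Type v} [Field k] [Monoid M] [Finite M] (P : IdemPair M)
  (hM : IsOrthogroup M)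
variable {U V : Type w} [AddCommGroup U] [Module k U] [AddCommGroup V] [Module k V]
variable (ρU : Representation k (MaxSubgroup P.idemX) U)
  (ρV : Representation k (MaxSubgroup P.idemY) V)

/-- The difference `[x] - [e_X x]` as a vector of `V_{X,Y}`. -/
noncomputable def diffVec (k : Type u) [Field k] (x : P.carrier) : P.space k hM.rectangular :=
  ⟨P.diff k hM.rectangular x, P.diff_mem_space k hM x⟩

theorem spaceRep_diffVec (g : MaxSubgroup P.idemY) (h : MaxSubgroup P.idemX) (x : P.carrier) :
    P.spaceRep k hM (g, h) (P.diffVec hM k x) =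
      P.diffVec hM k (P.act hM.rectangular g h x) -
        P.diffVec hM k (P.act hM.rectangular g h (P.retr hM.rectangular x)) := by
  apply Subtype.ext
  refine (P.spaceRep_isAction k hM g h x _).trans ?_
  rw [P.cls_act_sub k hM]
  rfl

theorem space_hom_ext {W : Type*} [AddCommGroup W] [Module k W]
    {f g : P.space k hM.rectangular →ₗ[k] W}
    (h : ∀ x, f (P.diffVec hM k x) = g (P.diffVec hM k x)) : f = g := by
  have key : ∀ (w : P.ClassSpace k) (hw : w ∈ P.space k hM.rectangular), f ⟨w, hw⟩ = g ⟨w, hw⟩ := by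
    intro w hw
    induction hw using Submodule.span_induction with
    | mem v hv =>
      obtain ⟨x, -, rfl⟩ := hv
      exact h x
    | zero => exact (map_zero f).trans (map_zero g).symm
    | add x y hx hy ihx ihy =>
      exact (map_add f ⟨x, hx⟩ ⟨y, hy⟩).trans
        ((congrArg₂ (· + ·) ihx ihy).trans (map_add g ⟨x, hx⟩ ⟨y, hy⟩).symm)
    | smul c x hx ih =>
      exact (map_smul f c ⟨x, hx⟩).trans
        ((congrArg (c • ·) ih).trans (map_smul g c ⟨x, hx⟩).symm)
  exact LinearMap.ext fun w => key w.1 w.2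

variable {ρU ρV} in
theorem cocycles_inflate_act {F : P.carrier → U →ₗ[k] V}
    (hF : F ∈ P.cocycles hM (inflate hM.rectangular ρU) (inflate hM.rectangular ρV))
    (g : MaxSubgroup P.idemY) (h : MaxSubgroup P.idemX) (x : P.carrier) :
    F (P.act hM.rectangular g h x) - F (P.act hM.rectangular g h (P.retr hM.rectangular x)) =
      ρV g ∘ₗ F x ∘ₗ ρU h⁻¹ := by
  rw [hF.2.2, inflate_val, inflate_val]

/-- Cocycles on `e_Y L_{e_X}` are the intertwining maps `V_{X,Y} → V ⊗ U*`. -/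
theorem nonempty_intertwining_equiv_cocycles [FiniteDimensional k U] :
    Nonempty (Representation.IntertwiningMap (P.spaceRep k hM) (tensorDual ρV ρU) ≃ₗ[k]
      P.cocycles hM (inflate hM.rectangular ρU) (inflate hM.rectangular ρV)) := by
  let E := tensorDualEquivHom k U V
  let Ψ : Representation.IntertwiningMap (P.spaceRep k hM) (tensorDual ρV ρU) →ₗ[k]
      P.cocycles hM (inflate hM.rectangular ρU) (inflate hM.rectangular ρV) :=
    { toFun := fun Φ => ⟨fun x => E (Φ (P.diffVec hM k x)), by
        refine ⟨fun x x' h => ?_, fun x => ?_, fun g h x => ?_⟩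
        · have : P.diffVec hM k x = P.diffVec hM k x' := Subtype.ext (P.diff_eq_of_rel k hM h)
          exact congrArg (fun v => E (Φ v)) this
        · have : P.diffVec hM k (P.retr hM.rectangular x) = 0 := Subtype.ext (P.diff_retr k hM x)
          exact (congrArg (fun v => E (Φ v)) this).trans
            ((congrArg E (map_zero Φ)).trans (map_zero E))
        · rw [← map_sub, ← map_sub, ← spaceRep_diffVec, Φ.isIntertwining,
            tensorDualEquivHom_apply, inflate_val, inflate_val]⟩
      map_add' := fun Φ Φ' => by
        apply Subtype.ext
        funext x
        exact map_add E _ _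
      map_smul' := fun c Φ => by
        apply Subtype.ext
        funext x
        exact map_smul E c _ }
  have hΨ : ∀ Φ x, (Ψ Φ).1 x = E (Φ (P.diffVec hM k x)) := fun _ _ => rfl
  refine ⟨LinearEquiv.ofBijective Ψ ⟨fun Φ Φ' h => ?_, fun F => ?_⟩⟩
  · apply Representation.IntertwiningMap.ext
    apply P.space_hom_ext hM
    intro x
    apply E.injective
    exact congrFun (congrArg Subtype.val h) x
  · have hlift : ∀ x x', P.equivRel x x' → F.1 x = F.1 x' := fun x x' h => by
      induction h with
      | rel x x' h => exact F.2.1 x x' h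
      | refl x => rfl
      | symm x y _ ih => exact ih.symm
      | trans x y z _ _ ih1 ih2 => exact ih1.trans ih2
    -- The linear extension of `F` to classes takes `[x] - [e_X x]` back to `F(x)`, because `F(e_X
    -- x) = 0`.
    let L : P.ClassSpace k →ₗ[k] U →ₗ[k] V :=
      Finsupp.linearCombination k (Quotient.lift F.1 hlift : P.Classes → U →ₗ[k] V)
    have hcls : ∀ x, L (P.cls k x) = F.1 x := fun x => by
      exact (Finsupp.linearCombination_single k 1 (P.mkClass x)).trans (one_smul k _)
    obtain ⟨f, hdiff⟩ : ∃ f : P.space k hM.rectangular →ₗ[k] V ⊗[k] Module.Dual k U,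
        ∀ x, E (f (P.diffVec hM k x)) = F.1 x := by
      refine ⟨E.symm.toLinearMap ∘ₗ L ∘ₗ (P.space k hM.rectangular).subtype, fun x => ?_⟩
      change E (E.symm (L (P.diff k hM.rectangular x))) = _
      rw [LinearEquiv.apply_symm_apply, diff, map_sub, hcls, hcls, F.2.2.1, sub_zero]
    have hf : ∀ gh, f ∘ₗ P.spaceRep k hM gh = tensorDual ρV ρU gh ∘ₗ f := by
      rintro ⟨g, h⟩
      apply P.space_hom_ext hM
      intro x
      apply E.injective
      have hE := tensorDualEquivHom_apply ρV ρU g h (f (P.diffVec hM k x))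
      refine Eq.trans ?_ hE.symm
      rw [LinearMap.comp_apply, spaceRep_diffVec, map_sub f, map_sub E]
      refine (congrArg₂ (· - ·) (hdiff _) (hdiff _)).trans ?_
      rw [P.cocycles_inflate_act hM F.2]
      exact (congrArg (fun a => ρV g ∘ₗ a ∘ₗ ρU h⁻¹) (hdiff x)).symm
    exact ⟨⟨f, hf⟩, Subtype.ext (funext hdiff)⟩

end ArrowFormula

/-- The arrow formula for full representations of the maximal subgroups. -/
theorem arrowFormula {k : Type u} {M : Type v} [Field k] [Monoid M] [Finite M] (P : IdemPair M)
    (hM : IsOrthogroup M) {U V : Type (max u v)} [AddCommGroup U] [Module k U] [AddCommGroup V]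
    [Module k V] [FiniteDimensional k U] [FiniteDimensional k V] [Nontrivial U] [Nontrivial V]
    {ρU : Representation k (MaxSubgroup P.idemX) U} {ρV : Representation k (MaxSubgroup P.idemY) V}
    (hU : IsFull ρU) (hV : IsFull ρV) (hcX : (Nat.card (MaxSubgroup P.idemX) : k) ≠ 0)
    (hcY : (Nat.card (MaxSubgroup P.idemY) : k) ≠ 0) (hlt : P.eY ∉ twoSided P.eX) :
    P.ArrowFormula hM.rectangular ρU ρV := by
  have hnt : Nontrivial (V ⊗[k] Module.Dual k U) := nontrivial_tensorDual
  have hfull : IsFull (tensorDual ρV ρU) := hV.tprod hU.dual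
  have hcard : (Nat.card (MaxSubgroup P.idemY × MaxSubgroup P.idemX) : k) ≠ 0 := by
    rw [Nat.card_prod, Nat.cast_mul]
    exact mul_ne_zero hcY hcX
  have : Finite P.carrier := Subtype.finite
  have : Finite P.Classes := Quotient.finite _
  obtain ⟨n, hn, hrank⟩ := exists_hasMultiplicity
    (G := MaxSubgroup P.idemY × MaxSubgroup P.idemX) (R := P.space k hM.rectangular) hcard
    hfull.isIrreducible hfull.hasScalarCommutant (P.spaceRep k hM)
  obtain ⟨e⟩ := P.nonempty_intertwining_equiv_cocycles hM ρU ρV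
  refine ⟨P.linearIndepOn_diffSet k hM, hfull.isIrreducible, P.spaceRep k hM,
    P.spaceRep_isAction k hM, n, hn, ?_⟩
  rw [P.numArrows_eq_rank_cocycles hM _ _ (inflate_idem _ ρU)
    (fun m => inflate_of_notMem _ ρU) (inflate_idem _ ρV) (fun m => inflate_of_notMem _ ρV) hlt,
    ← e.rank_eq, hrank]

end IdemPair

/-! ### Maximal subgroups and dual representations of the opposite monoid. -/

section Opposite

open MulOpposite

variable {k : Type u} {M : Type v} [Field k] [Monoid M]

theorem maxSubgroupOp_val {e : M} {he : IsIdempotentElem e}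
    (g : MaxSubgroup (isIdempotentElem_op he)) : (maxSubgroupOp he g).unop.val = g.val.unop := rfl

theorem maxSubgroupOp_bijective {e : M} (he : IsIdempotentElem e) :
    Function.Bijective (maxSubgroupOp he) := by
  constructor
  · intro g h hgh
    apply MaxSubgroup.ext
    apply unop_injective
    rw [← maxSubgroupOp_val, ← maxSubgroupOp_val, hgh]
  · intro g
    have h : ∀ x : LocalMonoid he, op e * op x.1 = op x.1 ∧ op x.1 * op e = op x.1 := fun x =>
      ⟨congrArg op x.2.2, congrArg op x.2.1⟩
    refine ⟨⟨⟨op g.unop.val, h _⟩, ⟨op (g.unop⁻¹).val, h _⟩, ?_, ?_⟩, ?_⟩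
    · exact Subtype.ext (congrArg op g.unop.inv_mul_val)
    · exact Subtype.ext (congrArg op g.unop.mul_inv_val)
    · apply unop_injective
      apply MaxSubgroup.ext
      rfl

theorem card_maxSubgroup_op {e : M} (he : IsIdempotentElem e) :
    Nat.card (MaxSubgroup (isIdempotentElem_op he)) = Nat.card (MaxSubgroup he) :=
  (Nat.card_congr (Equiv.ofBijective _ (maxSubgroupOp_bijective he))).trans
    (Nat.card_congr opEquiv.symm)

variable {U V : Type w} [AddCommGroup U] [Module k U] [AddCommGroup V] [Module k V]

theorem dualOp_apply {e : M} {he : IsIdempotentElem e} (ρ : Representation k (MaxSubgroup he) U)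
    (g : MaxSubgroup (isIdempotentElem_op he)) :
    dualOp ρ g = (ρ (maxSubgroupOp he g).unop).dualMap := rfl

theorem IsFull.dualOp [FiniteDimensional k U] {e : M} {he : IsIdempotentElem e}
    {ρ : Representation k (MaxSubgroup he) U} (h : IsFull ρ) :
    IsFull (dualOp ρ) := by
  have := span_range_transpose h
  rw [IsFull, eq_top_iff, ← this]
  refine Submodule.span_mono ?_
  rintro _ ⟨_, ⟨g, rfl⟩, rfl⟩
  obtain ⟨g', hg'⟩ := (maxSubgroupOp_bijective he).2 (op g)
  exact ⟨g', by rw [dualOp_apply, hg', unop_op]⟩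

theorem inflate_dualOp [Finite M] (hM : IsRectangular M) {e : M} {he : IsIdempotentElem e}
    (ρ : Representation k (MaxSubgroup he) U) (m : M) :
    inflate hM.op (dualOp ρ) (op m) = (inflate hM ρ m).dualMap := by
  by_cases hm : e ∈ twoSided m
  · obtain ⟨g, hg⟩ := exists_maxSubgroup hM he hm
    obtain ⟨g', hg'⟩ := (maxSubgroupOp_bijective he).2 (op g)
    have h1 : g'.val = op e * op m * op e := by
      apply unop_injective
      rw [← maxSubgroupOp_val (he := he) g', hg', unop_op, hg]
      simp only [unop_mul, unop_op, mul_assoc]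
    have h2 : inflate hM.op (dualOp ρ) (op m) = dualOp ρ g' := by
      rw [← inflate_val hM.op (dualOp ρ) g', h1, map_mul, map_mul,
        inflate_idem hM.op (dualOp ρ), one_mul, mul_one]
    have h3 : inflate hM ρ m = ρ g := by
      rw [← inflate_val hM ρ g, hg, map_mul, map_mul, inflate_idem, one_mul, mul_one]
    rw [h2, h3, dualOp_apply, hg', unop_op]
  · have hm' : op e ∉ twoSided (op m) := fun h => hm (mem_twoSided_op.1 h)
    rw [inflate_of_notMem hM _ hm, inflate_of_notMem hM.op _ hm']
    exact (map_zero Module.Dual.transpose).symm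

end Opposite

/-! ### Transposition of crossed homomorphisms. -/

section NumArrowsOp

open MulOpposite

variable {k : Type u} {M : Type v} [Field k] [Monoid M]

/-- Transposition of crossed homomorphisms. -/
def crossedHom.transpose {U V : Type w} [AddCommGroup U] [Module k U] [AddCommGroup V] [Module k V]
    {ρ : Representation k M U} {σ : Representation k M V}
    {σ' : Representation k Mᵐᵒᵖ (Module.Dual k V)} {ρ' : Representation k Mᵐᵒᵖ (Module.Dual k U)}
    (hσ : ∀ m, σ' (op m) = (σ m).dualMap) (hρ : ∀ m, ρ' (op m) = (ρ m).dualMap) :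
    crossedHom ρ σ →ₗ[k] crossedHom σ' ρ' where
  toFun d := ⟨fun m => Module.Dual.transpose (d.1 m.unop), fun m n => by
    change Module.Dual.transpose (d.1 (n.unop * m.unop)) = _
    rw [d.2, map_add, add_comm, Module.Dual.transpose_comp, Module.Dual.transpose_comp,
      ← op_unop m, ← op_unop n, hσ, hρ]
    rfl⟩
  map_add' d d' := Subtype.ext (funext fun _ => map_add Module.Dual.transpose _ _)
  map_smul' c d := Subtype.ext (funext fun _ => map_smul Module.Dual.transpose c _)

/-- The number of arrows depends only on the crossed homomorphisms modulo the inner ones. -/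
theorem numArrows_congr {N : Type v} [Monoid N] {U V U' V' : Type (max u v)} [AddCommGroup U]
    [Module k U] [AddCommGroup V] [Module k V] [AddCommGroup U'] [Module k U'] [AddCommGroup V']
    [Module k V'] {ρ : Representation k M U} {σ : Representation k M V}
    {ρ' : Representation k N U'} {σ' : Representation k N V'}
    (t : crossedHom ρ σ →ₗ[k] crossedHom ρ' σ') (ht : Function.Bijective t)
    (h : (LinearMap.range (innerHom ρ σ)).map t = LinearMap.range (innerHom ρ' σ')) :
    numArrows ρ σ = numArrows ρ' σ' := by
  obtain ⟨q, hq, hker⟩ := exists_crossedHom_ext ρ σ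
  obtain ⟨q', hq', hker'⟩ := exists_crossedHom_ext ρ' σ'
  rw [← hker, ← hker'] at h
  exact (((q.quotKerEquivOfSurjective hq).symm.trans
    (Submodule.Quotient.equiv _ _ (LinearEquiv.ofBijective t ht) h)).trans
      (q'.quotKerEquivOfSurjective hq')).rank_eq

/-- Passing to dual spaces reverses the arrows. -/
theorem numArrows_transpose {U V : Type (max u v)} [AddCommGroup U] [Module k U] [AddCommGroup V]
    [Module k V] [FiniteDimensional k U] [FiniteDimensional k V]
    {ρ : Representation k M U} {σ : Representation k M V}
    {σ' : Representation k Mᵐᵒᵖ (Module.Dual k V)} {ρ' : Representation k Mᵐᵒᵖ (Module.Dual k U)}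
    (hσ : ∀ m, σ' (op m) = (σ m).dualMap) (hρ : ∀ m, ρ' (op m) = (ρ m).dualMap) :
    numArrows ρ σ = numArrows σ' ρ' := by
  let t := crossedHom.transpose hσ hρ
  have hinj : Function.Injective t := fun d d' h =>
    Subtype.ext (funext fun m => transpose_injective (congrFun (congrArg Subtype.val h) (op m)))
  -- Transposing exchanges the two terms of `σ φ - φ ρ`, which accounts for the sign.
  have hinner : ∀ φ, t (innerHom ρ σ φ) = innerHom σ' ρ' (-Module.Dual.transpose φ) := by
    intro φ
    apply Subtype.ext
    funext m
    ext l u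
    rw [innerHom_apply, ← op_unop m, hσ, hρ]
    change l (σ m.unop (φ u) - φ (ρ m.unop u)) = -l (φ (ρ m.unop u)) - -l (σ m.unop (φ u))
    rw [map_sub]; abel
  have hsurj : Function.Surjective t := by
    intro d'
    choose d hd using fun m : M => transpose_surjective (k := k) (U := U) (V := V) (d'.1 (op m))
    refine ⟨⟨d, fun m n => transpose_injective ?_⟩, Subtype.ext (funext fun m => hd m.unop)⟩
    rw [hd, op_mul, d'.2, map_add, Module.Dual.transpose_comp, Module.Dual.transpose_comp, hd, hd,
      hσ, hρ, add_comm]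
    rfl
  refine numArrows_congr t ⟨hinj, hsurj⟩ (SetLike.ext fun d' => ⟨?_, ?_⟩)
  · rintro ⟨_, ⟨φ, rfl⟩, rfl⟩
    exact ⟨_, (hinner φ).symm⟩
  · rintro ⟨ψ, rfl⟩
    obtain ⟨φ, hφ⟩ := transpose_surjective (k := k) (U := U) (V := V) (-ψ)
    refine ⟨_, ⟨φ, rfl⟩, (hinner φ).trans (congrArg (innerHom σ' ρ') ?_)⟩
    rw [hφ]
    exact neg_neg ψ

end NumArrowsOp

/-! ### Change of idempotent inside a conjugacy class. -/

section Conjugation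

variable {k : Type u} {M : Type v} [Field k] [Monoid M] [Finite M]
variable {U : Type w} [AddCommGroup U] [Module k U]

/-- Apply the representation to `efe = e`, where `e` acts as the identity. -/
theorem inflate_eq_one (hM : IsRectangular M) {e f : M} {he : IsIdempotentElem e}
    (hf : IsIdempotentElem f) (h : twoSided f = twoSided e)
    (ρ : Representation k (MaxSubgroup he) U) : inflate hM ρ f = 1 := by
  have h1 := congrArg (inflate hM ρ) (hM.sandwich he hf h.symm)
  rwa [map_mul, map_mul, inflate_idem, one_mul, mul_one] at h1

/-- The representation of `G_f` obtained from a representation of `G_e`, for conjugate idempotents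
`e` and `f`. -/
noncomputable def conjRep (hM : IsRectangular M) {e f : M} {he : IsIdempotentElem e}
    (hf : IsIdempotentElem f) (h : twoSided f = twoSided e)
    (ρ : Representation k (MaxSubgroup he) U) : Representation k (MaxSubgroup hf) U where
  toFun g := inflate hM ρ g.val
  map_one' := inflate_eq_one hM hf h ρ
  map_mul' g g' := map_mul (inflate hM ρ) g.val g'.val

theorem inflate_conjRep (hM : IsRectangular M) {e f : M} {he : IsIdempotentElem e}
    (hf : IsIdempotentElem f) (h : twoSided f = twoSided e)
    (ρ : Representation k (MaxSubgroup he) U) :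
    inflate hM (conjRep hM hf h ρ) = inflate hM ρ := by
  ext1 m
  by_cases hm : f ∈ twoSided m
  · obtain ⟨g, hg⟩ := exists_maxSubgroup hM hf hm
    have h1 := inflate_val hM (conjRep hM hf h ρ) g
    rw [hg, map_mul, map_mul, inflate_idem, one_mul, mul_one] at h1
    refine h1.trans (?_ : inflate hM ρ g.val = _)
    rw [hg, map_mul, map_mul, inflate_eq_one hM hf h, one_mul, mul_one]
  · have hm' : e ∉ twoSided m := fun h' => hm (mem_twoSided_trans (h ▸ mem_twoSided_self f) h')
    rw [inflate_of_notMem hM _ hm, inflate_of_notMem hM _ hm']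

theorem conjRep_isIrreducible (hM : IsRectangular M) {e f : M} {he : IsIdempotentElem e}
    (hf : IsIdempotentElem f) (h : twoSided f = twoSided e)
    {ρ : Representation k (MaxSubgroup he) U} (hρ : ρ.IsIrreducible) :
    (conjRep hM hf h ρ).IsIrreducible := by
  have := nontrivial_of_isIrreducible hρ
  refine isIrreducible_of_forall _ fun W hW h0 => eq_top_of_isIrreducible hρ W (fun g w hw => ?_) h0
  rw [← inflate_val hM ρ g, ← inflate_conjRep hM hf h ρ]
  rcases exists_inflate_eq hM (conjRep hM hf h ρ) g.val with h1 | ⟨g', h1⟩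
  · rw [h1]; exact W.zero_mem
  · rw [h1]; exact hW g' w hw

/-- An idempotent below `e`, generating the same ideal as the idempotent `f`. -/
theorem IsRectangular.exists_idempotent_below (hM : IsRectangular M) {e f : M}
    (he : IsIdempotentElem e) (hf : IsIdempotentElem f) (h : f ∈ twoSided e) :
    ∃ f', IsIdempotentElem f' ∧ twoSided f' = twoSided f ∧ e * f' = f' ∧ f' * e = f' := by
  obtain ⟨g, hg⟩ := exists_maxSubgroup hM hf h
  -- The retraction onto `G_f` is multiplicative, so the image `fef` of the idempotent `e` is an
  -- idempotent of a group, that is, its identity `f`.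
  have hfef : f * e * f = f := by
    have h1 := hM.retract_mul hf h h
    rw [he.eq, ← hg, ← MaxSubgroup.val_mul] at h1
    have h2 : g = 1 := mul_eq_left.1 (MaxSubgroup.ext h1)
    rw [← hg, h2, MaxSubgroup.val_one]
  refine ⟨e * f * e, ?_, twoSided_eq ⟨e, e, rfl⟩ ⟨f, f, ?_⟩, ?_, ?_⟩
  · change e * f * e * (e * f * e) = e * f * e
    calc e * f * e * (e * f * e) = e * (f * (e * e) * f) * e := by simp only [mul_assoc]
      _ = e * f * e := by rw [he.eq, hfef]
  · calc f = f * e * f * e * f := by rw [hfef, hfef]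
      _ = f * (e * f * e) * f := by simp only [mul_assoc]
  · rw [← mul_assoc, ← mul_assoc, he.eq]
  · rw [mul_assoc, he.eq]

end Conjugation

end OrthogroupQuiver

/-! ### The quiver of an orthogroup algebra. -/

theorem mainTheorem6 {k : Type u} {M : Type v} [Field k] [Monoid M] [Finite M]
    (hM : IsOrthogroup M) (hk : IsSplittingField k M)
    (hchar : ∀ (e : M) (he : IsIdempotentElem e), ¬ ringChar k ∣ Nat.card (MaxSubgroup he))
    (X Y : SupportLattice M) {eX eY : M}
    (heX : IsIdempotentElem eX) (heY : IsIdempotentElem eY)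
    (hX : twoSided eX = X.1) (hY : twoSided eY = Y.1)
    {U V : Type (max u v)} [AddCommGroup U] [Module k U] [AddCommGroup V] [Module k V]
    (ρU : Representation k (MaxSubgroup heX) U) (hU : ρU.IsIrreducible)
    (ρV : Representation k (MaxSubgroup heY) V) (hV : ρV.IsIrreducible) :
    ((¬ X ≤ Y ∧ ¬ Y ≤ X) ∨ X = Y →
      numArrows (inflate hM.rectangular ρU) (inflate hM.rectangular ρV) = 0) ∧
    (X < Y →
      (∃ (f : M) (hf : IsIdempotentElem f) (ρU' : Representation k (MaxSubgroup hf) U),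
        twoSided f = X.1 ∧ eY * f = f ∧ f * eY = f ∧ f ≠ eY ∧ ρU'.IsIrreducible ∧
        inflate hM.rectangular ρU' = inflate hM.rectangular ρU) ∧
      ∀ (h₁ : eY * eX = eX) (h₂ : eX * eY = eX),
        (IdemPair.mk eX eY heX heY h₁ h₂).ArrowFormula hM.rectangular ρU ρV) ∧
    (Y < X →
      numArrows (inflate hM.rectangular ρU) (inflate hM.rectangular ρV) =
        numArrows (inflate hM.rectangular.op (dualOp ρV))
          (inflate hM.rectangular.op (dualOp ρU)) ∧
      ∀ (h₁ : eX * eY = eY) (h₂ : eY * eX = eY),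
        (IdemPair.mk eY eX heY heX h₁ h₂).op.ArrowFormula hM.rectangular.op
          (dualOp ρV) (dualOp ρU)) := by
  have hcard : ∀ (e : M) (he : IsIdempotentElem e), (Nat.card (MaxSubgroup he) : k) ≠ 0 :=
    fun e he h => hchar e he ((ringChar.spec k _).1 h)
  have := nontrivial_of_isIrreducible hU
  have := nontrivial_of_isIrreducible hV
  have := finiteDimensional_of_isIrreducible hU
  have := finiteDimensional_of_isIrreducible hV
  have hfU := hk.isFull hM.rectangular hU
  have hfV := hk.isFull hM.rectangular hV
  have hXY : eX ∈ twoSided eY ↔ X ≤ Y := by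
    rw [← twoSided_subset_iff, hX, hY]; rfl
  have hYX : eY ∈ twoSided eX ↔ Y ≤ X := by
    rw [← twoSided_subset_iff, hX, hY]; rfl
  refine ⟨?_, fun hlt => ⟨?_, fun h₁ h₂ => ?_⟩, fun hlt => ⟨?_, fun h₁ h₂ => ?_⟩⟩
  · rintro (⟨h1, h2⟩ | rfl)
    · exact numArrows_eq_zero _ _ (crossedHom_inner_of_incomparable hM
        (inflate_idem hM.rectangular ρU) (inflate_idem hM.rectangular ρV)
        (inflate_of_notMem hM.rectangular ρV (mt hYX.1 h2))
        (inflate_of_notMem hM.rectangular ρU (mt hXY.1 h1)))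
    · have heq : twoSided eX = twoSided eY := hX.trans hY.symm
      exact numArrows_eq_zero _ _ (crossedHom_inner_of_eq hM heX
        (inflate_idem hM.rectangular ρU) (inflate_eq_one hM.rectangular heX heq ρV)
        (fun m hm => inflate_of_notMem hM.rectangular ρU hm)
        (fun m hm => inflate_of_notMem hM.rectangular ρV fun h =>
          hm (mem_twoSided_trans (hXY.2 le_rfl) h))
        (hcard eX heX))
  · obtain ⟨f, hf, hfX, hf1, hf2⟩ :=
      hM.rectangular.exists_idempotent_below heY heX (hXY.2 hlt.le)
    refine ⟨f, hf, conjRep hM.rectangular hf hfX ρU, hfX.trans hX, hf1, hf2, ?_,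
      conjRep_isIrreducible _ _ _ hU, inflate_conjRep _ _ _ _⟩
    rintro rfl
    exact hlt.ne (Subtype.ext (hX.symm.trans (hfX.symm.trans hY)))
  · exact IdemPair.arrowFormula _ hM hfU hfV (hcard _ _) (hcard _ _) (mt hYX.1 hlt.not_ge)
  · exact numArrows_transpose (inflate_dualOp hM.rectangular ρV) (inflate_dualOp hM.rectangular ρU)
  · refine IdemPair.arrowFormula _ hM.op hfV.dualOp hfU.dualOp ?_ ?_ ?_
    · exact fun h => hcard eY heY (by rwa [← card_maxSubgroup_op heY])
    · exact fun h => hcard eX heX (by rwa [← card_maxSubgroup_op heX])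
    · exact fun h => hlt.not_ge (hXY.1 (mem_twoSided_op.1 h))
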